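/- For an integer $p\ge 1$ equip $\{0,\dots,p-1\}^{\mathbb N}$ with the left shift $\sigma$ and the metric $d(u,v)=e^{-|u\wedge v|}$ ($d(u,u)=0$), where $|u\wedge v|$ is the length of the longest common prefix of $u\neq v$. Let $X$ be one of the following one-sided shift spaces. * An $S$-gap shift, for an infinite set $S\subset\{0,1,2,\dots\}$: the set of $x\in\{0,1\}^{\mathbb N}$ such that the number of $0$s between any two consecutive $1$s of $x$ lies in $S$. * A $\beta$-shift, for a real $\beta>1$: the set of $x\in\{0,\dots,\lceil\beta\rceil-1\}^{\mathbb N}$ such that $\sigma^j x\preceq w^\beta$ in the lexicographic order for all $j\ge 0$, where $w^\beta$ is the greedy $\beta$-expansion of $1$ with digits in $\{0,\dots,\lceil\beta\rceil-1\}$. (The result also holds if $w^\beta$ is replaced by the quasi-greedy expansion of $1$, which differs from $w^\beta$ only if $w^\beta$ ends in $0^\infty$.) Let $Y\subset\{0,\dots,q-1\}^{\mathbb N}$ be a factor of $X$, that is, $Y=\pi(X)$ for a continuous map $\pi$ on $X$ with $\pi\circ\sigma=\sigma\circ\pi$ (for example $Y=X$). Let $\mathcal L_n$ be the set of words of length $n$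 that occur in points of $Y$, let $h=\limsup_{n\to\infty}\frac1n\log\#\mathcal L_n$ be the topological entropy of $Y$, and for continuous $\varphi:Y\to\mathbb R$ let $S_n\varphi=\sum_{k=0}^{n-1}\varphi\circ\sigma^k$ and $$P(\varphi)=\limsup_{n\to\infty}\frac1n\log\sum_{w\in\mathcal L_n}\exp\Big(\sup_{x\in[w]\cap Y}S_n\varphi(x)\Big),$$ where $[w]$ is the set of sequences that begin with $w$. Then the following hold, where $\dim_H$ is Hausdorff dimension. 1. Let $\psi:\mathbb N\to(0,\infty)$ and $R(\psi)=\{x\in Y: d(\sigma^n x,x)<\psi(n)\text{ for infinitely many }n\}$. If $\liminf_{n\to\infty}\psi(n)>0$, then $\dim_H R(\psi)=h$. If $\psi$ is nonincreasing, then $$\dim_H R(\psi)=\frac{h}{1+b},\qquad b=\liminf_{n\to\infty}\frac{-\log\psi(n)}{n}\in[0,\infty],$$ where $h/(1+\infty)=0$. 2. Let $f:Y\to(0,\infty)$ be continuous and $R(f)=\{x\in Y: d(\sigma^n x,x)\le e^{-S_nf(x)}\text{ for infinitely many }n\}$. Then the equation $P(-s(f+1))=0$ has exactly one real solution $s$,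 and $\dim_H R(f)=s$. -/

import Mathlib

namespace SymbolicRecurrence

/-- The one-sided sequence space `{0, …, p-1}^ℕ`. -/
def SymSeq (p : ℕ) : Type := ℕ → Fin p

/-- The length of the longest common prefix of `u ≠ v` (the least index at which they differ). -/
noncomputable def commonPrefix {p : ℕ} (u v : SymSeq p) : ℕ :=
  PiNat.firstDiff (E := fun _ => Fin p) u v

open Classical in
/-- The distance `d(u,v) = e^{-|u ∧ v|}`, with `d(u,u) = 0`. -/
noncomputable def seqDist {p : ℕ} (u v : SymSeq p) : ℝ :=
  if u = v then 0 else Real.exp (-(commonPrefix u v : ℝ))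

theorem seqDist_self {p : ℕ} (u : SymSeq p) : seqDist u u = 0 := by
  simp [seqDist]

theorem seqDist_comm {p : ℕ} (u v : SymSeq p) : seqDist u v = seqDist v u := by
  have h : commonPrefix u v = commonPrefix v u :=
    PiNat.firstDiff_comm (E := fun _ => Fin p) u v
  by_cases huv : u = v
  · rw [huv]
  · have hvu : ¬ v = u := fun e => huv e.symm
    simp only [seqDist, huv, hvu, if_false, h]

theorem seqDist_nonneg {p : ℕ} (u v : SymSeq p) : 0 ≤ seqDist u v := by
  unfold seqDist
  split_ifs
  · exact le_rfl
  · exact (Real.exp_pos _).le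

theorem seqDist_triangle {p : ℕ} (u v w : SymSeq p) :
    seqDist u w ≤ seqDist u v + seqDist v w := by
  by_cases huw : u = w
  · subst huw
    rw [seqDist_self]
    exact add_nonneg (seqDist_nonneg _ _) (seqDist_nonneg _ _)
  by_cases huv : u = v
  · subst huv
    rw [seqDist_self, zero_add]
  by_cases hvw : v = w
  · subst hvw
    rw [seqDist_self, add_zero]
  have h : min (commonPrefix u v) (commonPrefix v w) ≤ commonPrefix u w :=
    PiNat.min_firstDiff_le (E := fun _ => Fin p) u v w huw
  simp only [seqDist, huw, huv, hvw, if_false]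
  rcases min_le_iff.mp h with h | h
  · have h' : (commonPrefix u v : ℝ) ≤ commonPrefix u w := by exact_mod_cast h
    have := Real.exp_le_exp.mpr (neg_le_neg h')
    have := Real.exp_pos (-(commonPrefix v w : ℝ))
    linarith
  · have h' : (commonPrefix v w : ℝ) ≤ commonPrefix u w := by exact_mod_cast h
    have := Real.exp_le_exp.mpr (neg_le_neg h')
    have := Real.exp_pos (-(commonPrefix u v : ℝ))
    linarith

/-- The sequence space with the metric `d(u,v) = e^{-|u ∧ v|}`
(which induces the product topology). -/
noncomputable instance instMetricSpaceSymSeq (p : ℕ) : MetricSpace (SymSeq p) where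
  dist := seqDist
  dist_self := seqDist_self
  dist_comm := seqDist_comm
  dist_triangle := seqDist_triangle
  eq_of_dist_eq_zero := by
    intro u v h
    by_contra huv
    have h' : seqDist u v = 0 := h
    simp only [seqDist, huv, if_false] at h'
    exact (Real.exp_pos _).ne' h'

/-- The left shift `σ`. -/
def shift {p : ℕ} (x : SymSeq p) : SymSeq p := fun n => x (n + 1)

/-- `Y` is a factor of `X`: the image of `X` under a continuous map commuting with the shifts. -/
def IsFactor {p q : ℕ} (X : Set (SymSeq p)) (Y : Set (SymSeq q)) : Prop :=
  ∃ π : SymSeq p → SymSeq q,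
    ContinuousOn π X ∧ π '' X = Y ∧ ∀ x ∈ X, π (shift x) = shift (π x)

/-- The points of `X` that begin with the word `w`. -/
def cylinder {p n : ℕ} (X : Set (SymSeq p)) (w : Fin n → Fin p) : Set (SymSeq p) :=
  {x | x ∈ X ∧ ∀ i : Fin n, x i = w i}

/-- The words of length `n` in the language of `X`.  For a shift-invariant `X` a word that
occurs somewhere in a point of `X` is also the initial word of a point of `X`. -/
def language {p : ℕ} (X : Set (SymSeq p)) (n : ℕ) : Set (Fin n → Fin p) :=
  {w | (cylinder X w).Nonempty}

/-- Topological entropy of a subshift: `limsup (1/n) log #L_n(X)`. -/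
noncomputable def entropy {p : ℕ} (X : Set (SymSeq p)) : EReal :=
  Filter.limsup
    (fun n : ℕ => ((Real.log ((language X n).ncard : ℝ) / n : ℝ) : EReal)) Filter.atTop

open Classical in
/-- `Λ_n(φ) = ∑_{w ∈ L_n(X)} exp (sup_{x ∈ [w] ∩ X} S_n φ(x))`. -/
noncomputable def partitionSum {p : ℕ} (X : Set (SymSeq p)) (φ : SymSeq p → ℝ) (n : ℕ) : ℝ :=
  ∑ w : Fin n → Fin p with w ∈ language X n,
    Real.exp (sSup (birkhoffSum shift φ n '' cylinder X w))

/-- Topological pressure `P(φ) = limsup (1/n) log Λ_n(φ)`. -/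
noncomputable def pressure {p : ℕ} (X : Set (SymSeq p)) (φ : SymSeq p → ℝ) : EReal :=
  Filter.limsup
    (fun n : ℕ => ((Real.log (partitionSum X φ n) / n : ℝ) : EReal)) Filter.atTop

/-- `R(ψ)`: the points `x ∈ X` with `d(σⁿ x, x) < ψ(n)` for infinitely many `n`. -/
def recurrenceSet {p : ℕ} (X : Set (SymSeq p)) (ψ : ℕ → ℝ) : Set (SymSeq p) :=
  {x | x ∈ X ∧ {n : ℕ | dist (shift^[n] x) x < ψ n}.Infinite}

/-- `R(f)`: the points `x ∈ X` with `d(σⁿ x, x) ≤ exp (-S_n f(x))` for infinitely many `n`. -/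
def birkhoffRecurrenceSet {p : ℕ} (X : Set (SymSeq p)) (f : SymSeq p → ℝ) :
    Set (SymSeq p) :=
  {x | x ∈ X ∧
    {n : ℕ | dist (shift^[n] x) x ≤ Real.exp (-birkhoffSum shift f n x)}.Infinite}

/-- The decay rate `b = liminf (-log ψ(n)) / n`, possibly `+∞`. -/
noncomputable def decayRate (ψ : ℕ → ℝ) : EReal :=
  Filter.liminf (fun n : ℕ => ((-Real.log (ψ n) / n : ℝ) : EReal)) Filter.atTop

/-- The (one-sided) `S`-gap shift: the number of `0`s between consecutive `1`s lies in `S`. -/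
def sGapShift (S : Set ℕ) : Set (SymSeq 2) :=
  {x | ∀ i n : ℕ, x i = 1 → x (i + n + 1) = 1 → (∀ k < n, x (i + k + 1) = 0) → n ∈ S}

/-- The remainders of the greedy expansion of `1` in base `β` with digits in
`{0, …, ⌈β⌉ - 1}`: at each step the largest admissible digit is removed. -/
noncomputable def greedyRemainder (β : ℝ) : ℕ → ℝ
  | 0 => 1
  | n + 1 => β * greedyRemainder β n -
      ((min ⌊β * greedyRemainder β n⌋₊ (⌈β⌉₊ - 1) : ℕ) : ℝ)

theorem ceil_pos_of_one_lt {β : ℝ} (hβ : 1 < β) : 0 < ⌈β⌉₊ :=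
  Nat.ceil_pos.mpr (lt_trans one_pos hβ)

/-- The greedy `β`-expansion `w_0 w_1 …` of `1`, so that `1 = ∑ w_j β^{-(j+1)}`. -/
noncomputable def greedyExpansion (β : ℝ) (hβ : 1 < β) : SymSeq ⌈β⌉₊ := fun n =>
  ⟨min ⌊β * greedyRemainder β n⌋₊ (⌈β⌉₊ - 1),
    lt_of_le_of_lt (min_le_right _ _) (Nat.sub_lt (ceil_pos_of_one_lt hβ) one_pos)⟩

/-- The remainders of the quasi-greedy (infinite greedy) expansion of `1` in base `β`: at each
step the largest digit that leaves a positive remainder is removed. -/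
noncomputable def quasiGreedyRemainder (β : ℝ) : ℕ → ℝ
  | 0 => 1
  | n + 1 => β * quasiGreedyRemainder β n - ((⌈β * quasiGreedyRemainder β n⌉₊ - 1 : ℕ) : ℝ)

theorem quasiGreedyRemainder_mem {β : ℝ} (hβ : 1 < β) (n : ℕ) :
    0 < quasiGreedyRemainder β n ∧ quasiGreedyRemainder β n ≤ 1 := by
  induction n with
  | zero => simp [quasiGreedyRemainder]
  | succ n ih =>
    have hpos : 0 < β * quasiGreedyRemainder β n := mul_pos (by linarith) ih.1
    have h1 : 1 ≤ ⌈β * quasiGreedyRemainder β n⌉₊ := Nat.ceil_pos.mpr hpos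
    have h2 := Nat.ceil_lt_add_one hpos.le
    have h3 := Nat.le_ceil (β * quasiGreedyRemainder β n)
    simp only [quasiGreedyRemainder]
    rw [Nat.cast_sub h1]
    push_cast
    constructor <;> linarith

/-- The quasi-greedy `β`-expansion of `1`; it equals the greedy one unless that ends in `0^∞`. -/
noncomputable def quasiGreedyExpansion (β : ℝ) (hβ : 1 < β) : SymSeq ⌈β⌉₊ := fun n =>
  ⟨⌈β * quasiGreedyRemainder β n⌉₊ - 1, by
    have h := quasiGreedyRemainder_mem hβ n
    have h1 : ⌈β * quasiGreedyRemainder β n⌉₊ ≤ ⌈β⌉₊ := Nat.ceil_mono (by nlinarith [h.2])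
    have h2 : 0 < ⌈β⌉₊ := ceil_pos_of_one_lt hβ
    omega⟩

/-- The sequences all of whose shifts (including the sequence itself) are lexicographically at
most `w`. -/
def lexShift {p : ℕ} (w : SymSeq p) : Set (SymSeq p) :=
  {x | ∀ j : ℕ, toLex (α := ℕ → Fin p) (shift^[j] x) ≤ toLex (α := ℕ → Fin p) w}

/-- `X` is an `S`-gap shift with `S` infinite, or a `β`-shift with `β > 1`.  The `β`-shift is
the set of sequences all of whose shifts are at most the expansion of `1`.  When the greedy
expansion of `1` is finite, two conventions are in use (greedy or quasi-greedy expansion of `1`);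
both are included. -/
inductive IsSGapOrBetaShift : (p : ℕ) → Set (SymSeq p) → Prop
  | sGap (S : Set ℕ) (hS : S.Infinite) : IsSGapOrBetaShift 2 (sGapShift S)
  | beta (β : ℝ) (hβ : 1 < β) : IsSGapOrBetaShift ⌈β⌉₊ (lexShift (greedyExpansion β hβ))
  | betaQuasi (β : ℝ) (hβ : 1 < β) :
      IsSGapOrBetaShift ⌈β⌉₊ (lexShift (quasiGreedyExpansion β hβ))

end SymbolicRecurrence

open SymbolicRecurrence

/-! Upper bounds come from a natural cover. If two points share their first n letters and both
return at time n within e^{-c}, each copies itself with period n for about c further letters, so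
they are at distance at most e^{-(n+c)} (`dist_le_of_return`). Summing diam^t over the words of
length n gives about e^{(h-t(1+b))n} for R(ψ), and the partition sum of -t(f+1) for R(f).
Exponential decay of these sums bounds the dimension by t (`dimH_le_of_covers`).

Lower bounds need free concatenation. In an S-gap or β-shift a word splits into a prefix of a fixed
sequence, a freely concatenable middle and a prefix of another fixed sequence (`IsDecomposable`).
The cut points take polynomially many values and a factor map is a sliding block code, so
pigeonholing keeps exponentially many words of Y with a common middle window, at a subexponential
loss. This codes a full shift into Y at the same growth rate (`exists_horseshoe`).

In the full shift, prescribe sparse times M at which the next aM symbols repeat the start. The free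
positions have lower density about 1/(1+a), worst at the end of a copied block. Reading them as
base-b digits gives a Hölder map onto [0,1], so the image in Y of this set has dimension at least
any r with rN(1+a) < log b (`exists_recurrent_dimH_ge`). For R(f), the words are first sorted by the
integer part of S_n f; one class carries nearly the whole partition sum, and its value of S_n f
fixes a.

The pressure equation has one root because t ↦ P(-t(f+1)) is continuous and decreases at rate at
least 1 (`exists_pressure_zero`). -/

namespace SymbolicRecurrence

open Filter MeasureTheory Set
open scoped ENNReal NNReal Topology

/-! ### Prefix metric, compactness and sliding block codes. -/

section Metric

variable {p : ℕ}

/-- The exponent is real so that rates such as `a * M * N - m` and values of Birkhoff sums enter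
without rounding. -/
theorem dist_le_exp_neg_iff (u v : SymSeq p) (c : ℝ) :
    dist u v ≤ Real.exp (-c) ↔ ∀ l : ℕ, (l : ℝ) < c → u l = v l := by
  change seqDist u v ≤ _ ↔ _
  by_cases h : u = v
  · subst h
    simp [seqDist_self, (Real.exp_pos _).le]
  · simp only [seqDist, h, if_false, Real.exp_le_exp, neg_le_neg_iff]
    constructor
    · intro hc l hl
      have : l < commonPrefix u v := by exact_mod_cast hl.trans_le hc
      exact PiNat.apply_eq_of_lt_firstDiff (E := fun _ => Fin p) this
    · intro hl
      by_contra! hc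
      exact PiNat.apply_firstDiff_ne (E := fun _ => Fin p) h (hl _ hc)

theorem dist_le_exp_neg_natCast_iff (u v : SymSeq p) (n : ℕ) :
    dist u v ≤ Real.exp (-(n : ℝ)) ↔ ∀ l < n, u l = v l := by
  rw [dist_le_exp_neg_iff]
  simp

theorem shift_iterate_apply (x : SymSeq p) (n l : ℕ) : shift^[n] x l = x (l + n) := by
  induction n generalizing x with
  | zero => rfl
  | succ n ih =>
    rw [Function.iterate_succ_apply, ih]
    rfl

theorem shift_iterate_mem {X : Set (SymSeq p)} (hX : MapsTo shift X X) {x : SymSeq p}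
    (hx : x ∈ X) (n : ℕ) : shift^[n] x ∈ X :=
  hX.iterate n hx

theorem tendsto_exp_neg_natCast : Tendsto (fun n : ℕ => Real.exp (-(n : ℝ))) atTop (𝓝 0) :=
  Real.tendsto_exp_neg_atTop_nhds_zero.comp tendsto_natCast_atTop_atTop

/-- The identity, from the product topology to the metric topology. -/
def ofPi (x : ℕ → Fin p) : SymSeq p := x

/-- This direction suffices for compactness: the sequence space is a continuous image of Tychonoff's
compact product. -/
theorem continuous_ofPi : Continuous (ofPi (p := p)) := by
  rw [continuous_iff_continuousAt]
  intro x
  rw [ContinuousAt, Metric.tendsto_nhds]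
  intro ε hε
  obtain ⟨n, hn⟩ := (tendsto_exp_neg_natCast.eventually (gt_mem_nhds hε)).exists
  filter_upwards [(PiNat.isOpen_cylinder (E := fun _ => Fin p) x n).mem_nhds
    (PiNat.self_mem_cylinder x n)] with y hy
  refine lt_of_le_of_lt ((dist_le_exp_neg_natCast_iff _ _ n).2 fun l hl => ?_) hn
  exact hy l hl

instance : CompactSpace (SymSeq p) where
  isCompact_univ := by
    have h := isCompact_range (continuous_ofPi (p := p))
    convert h
    ext x
    simp only [mem_univ, true_iff]
    exact ⟨x, rfl⟩

/-- A set is closed once it contains every sequence all of whose prefixes it sees. -/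
theorem isClosed_of_prefix {X : Set (SymSeq p)}
    (h : ∀ x : SymSeq p, (∀ n : ℕ, ∃ y ∈ X, ∀ l < n, y l = x l) → x ∈ X) : IsClosed X := by
  refine isClosed_of_closure_subset fun x hx => h x fun n => ?_
  obtain ⟨y, hy, hd⟩ := Metric.mem_closure_iff.1 hx _ (Real.exp_pos (-(n : ℝ)))
  exact ⟨y, hy, fun l hl => ((dist_le_exp_neg_natCast_iff _ _ n).1 hd.le l hl).symm⟩

/-- Uniform continuity in terms of prefixes; it serves both the factor map and the potential `f`. -/
theorem exists_prefix_dist_lt {M : Type*} [PseudoMetricSpace M] {X : Set (SymSeq p)}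
    (hX : IsCompact X) {g : SymSeq p → M} (hg : ContinuousOn g X) {ε : ℝ} (hε : 0 < ε) :
    ∃ m : ℕ, ∀ x ∈ X, ∀ y ∈ X, (∀ l < m, x l = y l) → dist (g x) (g y) < ε := by
  obtain ⟨δ, hδ, h⟩ := Metric.uniformContinuousOn_iff.1
    (hX.uniformContinuousOn_of_continuous hg) ε hε
  obtain ⟨m, hm⟩ := (tendsto_exp_neg_natCast.eventually (gt_mem_nhds hδ)).exists
  exact ⟨m, fun x hx y hy hl =>
    h x hx y hy (lt_of_le_of_lt ((dist_le_exp_neg_natCast_iff _ _ m).2 hl) hm)⟩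

/-- A shift-commuting continuous map is a sliding block code. -/
theorem exists_window {q : ℕ} {X : Set (SymSeq p)} (hX : IsCompact X) (hinv : MapsTo shift X X)
    {π : SymSeq p → SymSeq q} (hπ : ContinuousOn π X)
    (hcomm : ∀ x ∈ X, π (shift x) = shift (π x)) :
    ∃ m : ℕ, ∀ x ∈ X, ∀ y ∈ X, ∀ a b : ℕ, (∀ l < m, x (a + l) = y (b + l)) →
      π x a = π y b := by
  -- Distance below e^{-1} forces the letters at position 0 to agree; commutation with the shift
  -- carries this to every position.
  obtain ⟨m, hm⟩ := exists_prefix_dist_lt hX hπ (Real.exp_pos (-((1 : ℕ) : ℝ)))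
  have hiter : ∀ x ∈ X, ∀ n, π (shift^[n] x) = shift^[n] (π x) := by
    intro x hx n
    induction n with
    | zero => rfl
    | succ n ih =>
      rw [Function.iterate_succ_apply', Function.iterate_succ_apply',
        hcomm _ (shift_iterate_mem hinv hx n), ih]
  refine ⟨m, fun x hx y hy a b hl => ?_⟩
  have h := hm _ (shift_iterate_mem hinv hx a) _ (shift_iterate_mem hinv hy b) (fun l hlm => by
    rw [shift_iterate_apply, shift_iterate_apply, add_comm l a, add_comm l b, hl l hlm])
  have h0 := (dist_le_exp_neg_natCast_iff _ _ 1).1 h.le 0 one_pos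
  rw [hiter x hx, hiter y hy, shift_iterate_apply, shift_iterate_apply] at h0
  simpa using h0

/-- Two points with the same initial `n`-word, both nearly returning at time `n`, are close. -/
theorem dist_le_of_return {x y : SymSeq p} {n : ℕ} (hn : 0 < n) (hxy : ∀ l < n, x l = y l)
    {c : ℝ} (hx : dist (shift^[n] x) x ≤ Real.exp (-c))
    (hy : dist (shift^[n] y) y ≤ Real.exp (-c)) :
    dist x y ≤ Real.exp (-(n + c)) := by
  rw [dist_le_exp_neg_iff] at hx hy ⊢
  intro l
  induction l using Nat.strong_induction_on with
  | _ l ih =>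
    intro hl
    by_cases hln : l < n
    · exact hxy l hln
    · push Not at hln
      -- Past the first n letters, the return makes both points copy the letter n places earlier.
      obtain ⟨k, rfl⟩ := Nat.exists_eq_add_of_le' hln
      push_cast at hl
      have h1 := hx k (by linarith)
      have h2 := hy k (by linarith)
      rw [shift_iterate_apply] at h1 h2
      rw [h1, h2]
      exact ih k (by omega) (by
        have : (0 : ℝ) < n := by exact_mod_cast hn
        linarith)

end Metric

/-! ### Hausdorff dimension bounds from limsup covers. -/

section UpperBound

variable {q : ℕ}

theorem tsum_ite_le (f : ℕ → ℝ≥0∞) (K : ℕ) :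
    (∑' n : ℕ, if K ≤ n then f n else 0) = ∑' n : ℕ, f (n + K) := by
  have h := Summable.sum_add_tsum_nat_add' (f := fun n => if K ≤ n then f n else 0) (k := K)
    ENNReal.summable
  rw [← h, Finset.sum_eq_zero (fun i hi => if_neg (not_le.2 (Finset.mem_range.1 hi))), zero_add]
  simp

/-- Covering bound for the dimension of a limsup set of finite covers. -/
theorem dimH_le_of_covers {E : Set (SymSeq q)} (A : (n : ℕ) → (Fin n → Fin q) → Set (SymSeq q))
    (hE : ∀ x ∈ E, ∃ᶠ n in atTop, ∃ w, x ∈ A n w)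
    (hA : ∀ n w, ∀ x ∈ A n w, ∀ l : Fin n, x l = w l) {t : ℝ} (ht : 0 < t) {θ : ℝ}
    (hθ : 0 < θ)
    (hsum : ∀ᶠ n : ℕ in atTop,
      ∑ w, Metric.ediam (A n w) ^ t ≤ ENNReal.ofReal (Real.exp (-(θ * n)))) :
    dimH E ≤ ENNReal.ofReal t := by
  borelize (SymSeq q)
  have hθ1 : Real.exp (-θ) < 1 := Real.exp_lt_one_iff.2 (by linarith)
  have hpow : ∀ n : ℕ, Real.exp (-(θ * n)) = Real.exp (-θ) ^ n := fun n => by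
    rw [← Real.exp_nat_mul]; ring_nf
  -- The K-th cover uses only levels n ≥ K, padded by empty sets to keep one index type. Its members
  -- have diameter at most e^{-K}, and its sum is dominated by a geometric tail.
  set T : ℕ → ((n : ℕ) × (Fin n → Fin q)) → Set (SymSeq q) :=
    fun K i => if K ≤ i.1 then A i.1 i.2 else ∅ with hT
  have hbound : ∀ᶠ K : ℕ in atTop, ∑' i, Metric.ediam (T K i) ^ t
      ≤ ENNReal.ofReal (Real.exp (-θ) ^ K * (1 - Real.exp (-θ))⁻¹) := by
    obtain ⟨K0, hK0⟩ := eventually_atTop.1 hsum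
    filter_upwards [eventually_ge_atTop K0] with K hK
    rw [ENNReal.tsum_sigma' (f := fun i => Metric.ediam (T K i) ^ t)]
    have h1 : ∀ n : ℕ, (∑' w : Fin n → Fin q, Metric.ediam (T K ⟨n, w⟩) ^ t)
        ≤ if K ≤ n then ENNReal.ofReal (Real.exp (-θ) ^ n) else 0 := by
      intro n
      rw [tsum_fintype]
      split_ifs with h
      · simp only [hT, h, if_true, ← hpow]
        exact hK0 n (hK.trans h)
      · simp [hT, h, ht]
    refine (ENNReal.tsum_le_tsum h1).trans ?_
    rw [tsum_ite_le, ← ENNReal.ofReal_tsum_of_nonneg (fun n => by positivity)]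
    · simp_rw [pow_add]
      rw [tsum_mul_right, tsum_geometric_of_lt_one (Real.exp_pos _).le hθ1, mul_comm]
    · simp_rw [pow_add]
      exact (summable_geometric_of_lt_one (Real.exp_pos _).le hθ1).mul_right _
  have hlim : Tendsto (fun K : ℕ => ENNReal.ofReal (Real.exp (-θ) ^ K * (1 - Real.exp (-θ))⁻¹))
      atTop (𝓝 0) := by
    have := (tendsto_pow_atTop_nhds_zero_of_lt_one (Real.exp_pos (-θ)).le hθ1).mul_const
      ((1 - Real.exp (-θ))⁻¹)
    simpa using ENNReal.tendsto_ofReal this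
  have hmeas : μH[t] E = 0 := by
    have h := Measure.hausdorffMeasure_le_liminf_tsum t E
      (fun K : ℕ => ENNReal.ofReal (Real.exp (-(K : ℝ))))
      (by simpa using ENNReal.tendsto_ofReal tendsto_exp_neg_natCast) T
      (Eventually.of_forall fun K i => ?_) (Eventually.of_forall fun K => ?_)
    · refine le_antisymm (h.trans ?_) zero_le
      rw [← hlim.liminf_eq]
      exact liminf_le_liminf hbound
    · by_cases hK : K ≤ i.1
      · simp only [hT, hK, if_true]
        refine Metric.ediam_le fun x hx y hy => ?_
        rw [edist_dist]
        refine ENNReal.ofReal_le_ofReal ((dist_le_exp_neg_natCast_iff _ _ K).2 fun l hl => ?_)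
        have hl' := hl.trans_le hK
        exact (hA _ _ x hx ⟨l, hl'⟩).trans (hA _ _ y hy ⟨l, hl'⟩).symm
      · simp [hT, hK]
    · intro x hx
      obtain ⟨n, hn, w, hw⟩ := frequently_atTop.1 (hE x hx) K
      exact mem_iUnion.2 ⟨⟨n, w⟩, by simpa [hT, show K ≤ n from hn] using hw⟩
  have : μH[((⟨t, ht.le⟩ : ℝ≥0) : ℝ)] E ≠ ∞ := by
    change μH[t] E ≠ ∞
    simp [hmeas]
  refine (dimH_le_of_hausdorffMeasure_ne_top this).trans_eq ?_
  rw [ENNReal.ofReal, Real.toNNReal_of_nonneg ht.le]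
  rfl

end UpperBound

/-! ### A Moran-type set of sequences with prescribed repetitions. -/

section Moran

/-- Fill a sequence by copying from position `s n` whenever `s n < n`, and from `d` otherwise. -/
def fillCopy {α : Type*} (s : ℕ → ℕ) (d : ℕ → α) (n : ℕ) : α :=
  if s n < n then fillCopy s d (s n) else d n
termination_by n

theorem fillCopy_of_lt {α : Type*} {s : ℕ → ℕ} (d : ℕ → α) {n : ℕ} (h : s n < n) :
    fillCopy s d n = fillCopy s d (s n) := by
  rw [fillCopy, if_pos h]

theorem fillCopy_of_not_lt {α : Type*} {s : ℕ → ℕ} (d : ℕ → α) {n : ℕ} (h : ¬ s n < n) :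
    fillCopy s d n = d n := by
  rw [fillCopy, if_neg h]

/-- With T(M) the end of the block copied at time M, everything up to the last copied block is a
δ-fraction of the next time. -/
theorem exists_sparse_seq {P : ℕ → Prop} (hP : ∃ᶠ M in atTop, P M) (T : ℕ → ℕ) {δ : ℝ}
    (hδ : 0 < δ) :
    ∃ M : ℕ → ℕ, (∀ k, P (M k)) ∧ (∀ k, 0 < M k) ∧ (∀ k, T (M k) < M (k + 1)) ∧
      ∀ k, (T (M k) : ℝ) ≤ δ * M (k + 1) := by
  have hnext : ∀ B : ℕ, ∃ M : ℕ, P M ∧ B < M ∧ (B : ℝ) ≤ δ * M := by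
    intro B
    obtain ⟨M, hM, hPM⟩ := frequently_atTop.1 hP (max (B + 1) ⌈(B : ℝ) / δ⌉₊)
    refine ⟨M, hPM, (le_max_left _ _).trans hM, ?_⟩
    have : (B : ℝ) / δ ≤ M := (Nat.le_ceil _).trans (by exact_mod_cast (le_max_right _ _).trans hM)
    rw [div_le_iff₀ hδ] at this
    linarith
  choose F hF using hnext
  refine ⟨fun k => Nat.rec (F 0) (fun _ M => F (T M)) k, fun k => ?_, fun k => ?_, fun k => ?_,
    fun k => ?_⟩
  · cases k <;> exact (hF _).1
  · cases k
    · exact (hF 0).2.1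
    · exact (Nat.zero_le _).trans_lt (hF _).2.1
  · exact (hF _).2.1
  · exact (hF _).2.2

-- The symbols on `A` are free, all others are copied. Nearly every position below M k is free, and
-- then about a·M k positions are lost, so the density of `A` never falls much below 1/(1+a).
open Classical in
theorem exists_copy_pattern {P : ℕ → Prop} (hP : ∃ᶠ M in atTop, P M) {a : ℝ} (ha : 0 ≤ a)
    {δ : ℝ} (hδ : 0 < δ) (hδ1 : δ < 1) :
    ∃ A : Set ℕ, A.Infinite ∧
      (∀ i : ℕ, (1 - δ) * ((i : ℝ) - 1) ≤ (1 + a) * Nat.count (· ∈ A) i) ∧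
      ∃ M : ℕ → ℕ, StrictMono M ∧ (∀ k, P (M k)) ∧
        ∀ (α : Type) (e : ℕ → α), ∃ ω : ℕ → α, (∀ j, ω (Nat.nth (· ∈ A) j) = e j) ∧
          ∀ k i : ℕ, (i : ℝ) < a * M k → ω (M k + i) = ω i := by
  set T : ℕ → ℕ := fun M => M + ⌈a * M⌉₊ with hT
  obtain ⟨M, hPM, hpos, hTM, hsp⟩ := exists_sparse_seq hP T hδ
  have hMT : ∀ k, M k ≤ T (M k) := fun k => Nat.le_add_right _ _
  have hmono : StrictMono M := strictMono_nat_of_lt_succ fun k => (hMT k).trans_lt (hTM k)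
  have hlt : ∀ k k', k < k' → T (M k) < M k' := fun k k' h =>
    (hTM k).trans_le (hmono.monotone h)
  set A : Set ℕ := {n | ∀ k, M k ≤ n → T (M k) ≤ n} with hA
  have hTA : ∀ k, T (M k) ∈ A := by
    intro k k' h
    rcases le_or_gt k' k with h1 | h1
    · rcases h1.eq_or_lt with rfl | h2
      · exact le_rfl
      · exact (hlt _ _ h2).le.trans (hMT k)
    · exact absurd h (not_le.2 (hlt _ _ h1))
  have hinf : A.Infinite := by
    refine infinite_of_not_bddAbove ?_
    rintro ⟨B, hB⟩
    have h1 : M (B + 1) ≤ B := (hMT _).trans (hB (hTA (B + 1)))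
    have := hmono.le_apply (x := B + 1)
    omega
  have hfree : ∀ U V : ℕ, U ≤ V → (∀ n, U ≤ n → n < V → n ∈ A) →
      V - U ≤ Nat.count (· ∈ A) V := by
    intro U V hUV h
    obtain ⟨L, rfl⟩ := Nat.exists_eq_add_of_le hUV
    rw [Nat.count_add]
    have h2 : Nat.count (fun k => U + k ∈ A) L = L :=
      Nat.count_iff_forall.2 fun {n} hn => h _ (Nat.le_add_right _ _) (by omega)
    omega
  -- All positions between the end of one copied block and the next M are free, and what precedes
  -- them is at most a δ-fraction.
  have hcM : ∀ k, (1 - δ) * (M k : ℝ) ≤ Nat.count (· ∈ A) (M k) := by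
    intro k
    have hM0 : (0 : ℝ) < M k := by exact_mod_cast hpos k
    cases k with
    | zero =>
      have h := hfree 0 (M 0) (Nat.zero_le _) fun n _ hn k hk =>
        absurd ((hmono.monotone (Nat.zero_le k)).trans hk) (not_le.2 hn)
      have h' : (M 0 : ℝ) ≤ Nat.count (· ∈ A) (M 0) := by exact_mod_cast h
      nlinarith
    | succ k =>
      have h := hfree (T (M k)) (M (k + 1)) (hTM k).le fun n hn hn' k' hk' => by
        have : k' < k + 1 := hmono.lt_iff_lt.1 (hk'.trans_lt hn')
        rcases (Nat.lt_succ_iff.1 this).eq_or_lt with rfl | h2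
        · exact hn
        · exact (hlt _ _ h2).le.trans ((hMT k).trans hn)
      have h' : (M (k + 1) : ℝ) - T (M k) ≤ Nat.count (· ∈ A) (M (k + 1)) := by
        have : (M (k + 1) : ℝ) ≤ Nat.count (· ∈ A) (M (k + 1)) + T (M k) := by
          exact_mod_cast Nat.sub_le_iff_le_add.1 h
        linarith
      have := hsp k
      linarith
  refine ⟨A, hinf, ?_, M, hmono, hPM, ?_⟩
  · intro i
    induction i with
    | zero => simp; linarith
    | succ i ih =>
      -- A free position raises the right side more than the left. Inside a copied block the bound
      -- follows from the one at its start, since i + 1 < (1+a)·M k + 1; the `- 1` in the claim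
      -- absorbs the ceiling.
      by_cases hi : i ∈ A
      · rw [Nat.count_succ_eq_succ_count hi]
        push_cast
        nlinarith
      · simp only [hA, mem_ofPred_eq, not_forall, not_le] at hi
        obtain ⟨k, hk, hk'⟩ := hi
        have h1 : ((i + 1 : ℕ) : ℝ) ≤ M k + ⌈a * M k⌉₊ := by exact_mod_cast hk'
        have h2 := Nat.ceil_lt_add_one (show 0 ≤ a * (M k : ℝ) by positivity)
        have h3 : ((Nat.count (· ∈ A) (M k) : ℕ) : ℝ) ≤ Nat.count (· ∈ A) (i + 1) := by
          exact_mod_cast Nat.count_monotone _ (by omega)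
        calc (1 - δ) * (((i + 1 : ℕ) : ℝ) - 1) ≤ (1 - δ) * ((1 + a) * M k) := by
              refine mul_le_mul_of_nonneg_left ?_ (by linarith)
              linarith
          _ = (1 + a) * ((1 - δ) * M k) := by ring
          _ ≤ (1 + a) * Nat.count (· ∈ A) (i + 1) :=
              mul_le_mul_of_nonneg_left ((hcM k).trans h3) (by linarith)
  · intro α e
    have huniq : ∀ k k' n, M k ≤ n → n < T (M k) → M k' ≤ n → n < T (M k') → k = k' := by
      intro k k' n h1 h2 h3 h4
      rcases lt_trichotomy k k' with h | h | h
      · have := hlt _ _ h; omega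
      · exact h
      · have := hlt _ _ h; omega
    -- The default `n` marks a free position, since `fillCopy` copies only when s n < n. On a copied
    -- block M k > 0 ensures this inequality.
    set s : ℕ → ℕ := fun n => if h : ∃ k, M k ≤ n ∧ n < T (M k) then n - M h.choose else n with hs
    refine ⟨fillCopy s fun n => e (Nat.count (· ∈ A) n), fun j => ?_, fun k i hi => ?_⟩
    · have hmem : Nat.nth (· ∈ A) j ∈ A := Nat.nth_mem_of_infinite hinf j
      rw [fillCopy_of_not_lt, Nat.count_nth_of_infinite (p := (· ∈ A)) hinf]
      have : ¬ ∃ k, M k ≤ Nat.nth (· ∈ A) j ∧ Nat.nth (· ∈ A) j < T (M k) := by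
        rintro ⟨k, h1, h2⟩
        exact absurd (hmem k h1) (not_le.2 h2)
      simp only [hs, dif_neg this, lt_irrefl, not_false_iff]
    · have hex : ∃ k', M k' ≤ M k + i ∧ M k + i < T (M k') :=
        ⟨k, Nat.le_add_right _ _, Nat.add_lt_add_left (Nat.lt_ceil.2 hi) _⟩
      have hk : hex.choose = k := huniq _ _ _ hex.choose_spec.1 hex.choose_spec.2
        (Nat.le_add_right _ _) (Nat.add_lt_add_left (Nat.lt_ceil.2 hi) _)
      have hsi : s (M k + i) = i := by
        simp only [hs, dif_pos hex, hk]
        omega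
      rw [fillCopy_of_lt _ (by rw [hsi]; have := hpos k; omega), hsi]

/-- Dimension of a set of codings whose blocks repeat the whole prefix at infinitely many times. -/
theorem exists_recurrent_dimH_ge {q b N : ℕ} (hN : 0 < N) {a : ℝ} (ha : 0 ≤ a)
    (Θ : (ℕ → Fin b) → SymSeq q)
    (hsep : ∀ ω ω' k, (∀ l < (k + 1) * N, Θ ω l = Θ ω' l) → ω k = ω' k)
    {P : ℕ → Prop} (hP : ∃ᶠ M in atTop, P M) {r : ℝ} (hr : 0 < r)
    (hrb : r * (N * (1 + a)) < Real.log b) :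
    ∃ E : Set (ℕ → Fin b),
      (∀ ω ∈ E, ∃ᶠ M : ℕ in atTop, P M ∧ ∀ i : ℕ, (i : ℝ) < a * M → ω (M + i) = ω i) ∧
      ENNReal.ofReal r ≤ dimH (Θ '' E) := by
  classical
  have hN' : (0 : ℝ) < N := by exact_mod_cast hN
  have hpos : 0 < r * (N * (1 + a)) := by positivity
  have hlog : 0 < Real.log b := hpos.trans hrb
  have hb : 1 < b := by
    by_contra! h
    interval_cases b <;> simp at hlog
  have hb0 : (0 : ℝ) < b := by exact_mod_cast one_pos.trans hb
  -- Chosen so that (1 - δ) log b = rN(1 + a), which makes the Hölder exponent below exactly r.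
  set δ : ℝ := 1 - r * (N * (1 + a)) / Real.log b with hδ
  have hδ' : (1 - δ) * Real.log b = r * (N * (1 + a)) := by
    rw [hδ]; field_simp; ring
  have hδ0 : 0 < δ := by
    rw [hδ, sub_pos, div_lt_one hlog]; exact hrb
  have hδ1 : δ < 1 := by
    rw [hδ]; linarith [div_pos hpos hlog]
  obtain ⟨A, hinf, hcount, M, hmono, hPM, hfill⟩ := exists_copy_pattern hP ha hδ0 hδ1
  set E : Set (ℕ → Fin b) := {ω | ∀ k i : ℕ, (i : ℝ) < a * M k → ω (M k + i) = ω i} with hE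
  refine ⟨E, fun ω hω => ?_, ?_⟩
  · rw [frequently_atTop]
    exact fun K => ⟨M K, hmono.le_apply, hPM K, fun i hi => hω K i hi⟩
  have hinj : Function.Injective Θ := fun ω ω' h => by
    funext k
    exact hsep ω ω' k fun l _ => by rw [h]
  have : Nonempty (ℕ → Fin b) := ⟨fun _ => ⟨0, by omega⟩⟩
  -- Reads only the free coordinates, as a base-b expansion; the copied ones carry no information.
  set g : SymSeq q → ℝ :=
    fun y => Real.ofDigits fun j => Function.invFun Θ y (Nat.nth (· ∈ A) j) with hg
  have hgΘ : ∀ ω, g (Θ ω) = Real.ofDigits fun j => ω (Nat.nth (· ∈ A) j) := fun ω => by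
    simp only [hg, Function.leftInverse_invFun hinj ω]
  -- One rN pays for n ≤ (k+1)N, the other for the `- 1` in the density estimate.
  set C : ℝ := Real.exp (2 * (r * N)) with hC
  have hdist : ∀ ω ω', dist (g (Θ ω)) (g (Θ ω')) ≤ C * dist (Θ ω) (Θ ω') ^ r := by
    intro ω ω'
    by_cases h : Θ ω = Θ ω'
    · rw [h, dist_self]
      positivity
    obtain ⟨n, hn⟩ : ∃ n : ℕ, dist (Θ ω) (Θ ω') = Real.exp (-(n : ℝ)) := by
      refine ⟨commonPrefix (Θ ω) (Θ ω'), ?_⟩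
      change seqDist _ _ = _
      simp [seqDist, h]
    have hpre := (dist_le_exp_neg_natCast_iff _ _ n).1 hn.le
    set k := n / N with hk
    have hωk : ∀ l < k, ω l = ω' l := fun l hl => hsep ω ω' l fun l' hl' => hpre l' (by
      have h1 : (l + 1) * N ≤ k * N := Nat.mul_le_mul_right _ hl
      have h2 : k * N ≤ n := Nat.div_mul_le_self n N
      omega)
    have h1 : |g (Θ ω) - g (Θ ω')| ≤ ((b : ℝ) ^ Nat.count (· ∈ A) k)⁻¹ := by
      rw [hgΘ, hgΘ]
      exact Real.abs_ofDigits_sub_ofDigits_le fun j hj => hωk _ (Nat.nth_lt_of_lt_count hj)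
    rw [Real.dist_eq, hn, ← Real.exp_mul, hC, ← Real.exp_add]
    refine h1.trans ?_
    rw [← Real.exp_log hb0, ← Real.exp_nat_mul, ← Real.exp_neg, Real.exp_le_exp]
    have h2 := mul_le_mul_of_nonneg_right (hcount k) hlog.le
    have h3 : (n : ℝ) ≤ (k + 1) * N := by
      have := Nat.lt_div_mul_add (a := n) hN
      have : n ≤ (k + 1) * N := by rw [add_mul, one_mul]; exact this.le
      exact_mod_cast this
    have h4 : (1 + a) * (r * N * ((k : ℝ) - 1))
        ≤ (1 + a) * (Nat.count (· ∈ A) k * Real.log b) := by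
      calc _ = (1 - δ) * Real.log b * ((k : ℝ) - 1) := by rw [hδ']; ring
        _ ≤ _ := by linarith
    have h5 := le_of_mul_le_mul_left h4 (by linarith)
    nlinarith [mul_le_mul_of_nonneg_left h3 hr.le]
  have hholder : HolderOnWith C.toNNReal r.toNNReal g (Θ '' E) := by
    rintro _ ⟨ω, -, rfl⟩ _ ⟨ω', -, rfl⟩
    rw [edist_dist, edist_dist, Real.coe_toNNReal _ hr.le,
      ENNReal.ofReal_rpow_of_nonneg dist_nonneg hr.le]
    change _ ≤ ENNReal.ofReal C * _
    rw [← ENNReal.ofReal_mul (Real.exp_pos _).le]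
    exact ENNReal.ofReal_le_ofReal (hdist ω ω')
  -- Every digit sequence can be written on the free positions, so the r-Hölder map `g` is onto
  -- [0,1] and the source has dimension at least r.
  have himage : Icc (0 : ℝ) 1 ⊆ g '' (Θ '' E) := by
    intro x hx
    obtain ⟨e, -, rfl⟩ := Real.ofDigits_SurjOn hb hx
    obtain ⟨ω, hω, hωE⟩ := hfill (Fin b) e
    refine ⟨Θ ω, ⟨ω, hωE, rfl⟩, ?_⟩
    rw [hgΘ]
    simp only [hω]
  have hdim : dimH (Icc (0 : ℝ) 1) = 1 := by
    rw [Real.dimH_of_nonempty_interior (by rw [interior_Icc]; exact nonempty_Ioo.2 one_pos)]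
    simp
  have hr' : 0 < r.toNNReal := Real.toNNReal_pos.2 hr
  have h := (hdim.symm.le.trans (dimH_mono himage)).trans (hholder.dimH_image_le hr')
  rw [ENNReal.le_div_iff_mul_le (Or.inl (by simpa using hr)) (Or.inl (by simp)), one_mul] at h
  exact h

end Moran

/-! ### Free concatenation systems inside a factor. -/

section Horseshoe

/-- The sequence beginning with `x_i ⋯ x_{i+N-1}` and continuing as `z`. -/
def prepend {p : ℕ} (x : SymSeq p) (i N : ℕ) (z : SymSeq p) : SymSeq p :=
  fun l => if l < N then x (i + l) else z (l - N)

/-- Words of `X` are, up to a prefix and a suffix taken from two fixed sequences, words that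
can be freely concatenated inside `X`. -/
def IsDecomposable {p : ℕ} (X : Set (SymSeq p)) : Prop :=
  ∃ X₀ ⊆ X, X₀.Nonempty ∧ IsClosed X₀ ∧ ∃ c d : ℕ → Fin p, ∀ x ∈ X, ∀ n : ℕ, ∃ i j : ℕ,
    i ≤ j ∧ j ≤ n ∧ (∀ l < i, x l = c l) ∧ (∀ l, j ≤ l → l < n → x l = d (l - j)) ∧
      ∀ z ∈ X₀, prepend x i (j - i) z ∈ X₀

/-- The concatenation of the words `(x_{ω k})_i ⋯ (x_{ω k})_{i+N-1}`. -/
def concatWords {p : ℕ} {ι : Type*} (x : ι → SymSeq p) (i N : ℕ) (ω : ℕ → ι) : SymSeq p :=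
  fun l => x (ω (l / N)) (i + l % N)

theorem concatWords_apply {p : ℕ} {ι : Type*} (x : ι → SymSeq p) (i : ℕ) {N : ℕ} (ω : ℕ → ι)
    (k : ℕ) {r : ℕ} (hr : r < N) : concatWords x i N ω (k * N + r) = x (ω k) (i + r) := by
  have hN : 0 < N := (Nat.zero_le r).trans_lt hr
  have h1 : (k * N + r) / N = k := by
    rw [add_comm, Nat.add_mul_div_right _ _ hN, Nat.div_eq_of_lt hr, zero_add]
  have h2 : (k * N + r) % N = r := by
    rw [add_comm, Nat.add_mul_mod_self_right, Nat.mod_eq_of_lt hr]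
  simp only [concatWords, h1, h2]

theorem mem_of_forall_prefix {p : ℕ} {X : Set (SymSeq p)} (hX : IsClosed X) {x : SymSeq p}
    (h : ∀ n : ℕ, ∃ y ∈ X, ∀ l < n, x l = y l) : x ∈ X := by
  rw [← hX.closure_eq, Metric.mem_closure_iff]
  intro ε hε
  obtain ⟨n, hn⟩ := (tendsto_exp_neg_natCast.eventually (gt_mem_nhds hε)).exists
  obtain ⟨y, hy, hxy⟩ := h n
  exact ⟨y, hy, lt_of_le_of_lt ((dist_le_exp_neg_natCast_iff _ _ n).2 hxy) hn⟩

/-- Prepending one block at a time to a point of `X₀` realises every finite concatenation as a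
prefix; closedness gives the infinite one. -/
theorem concatWords_mem {p : ℕ} {ι : Type*} {X₀ : Set (SymSeq p)} (hne : X₀.Nonempty)
    (hcl : IsClosed X₀) (x : ι → SymSeq p) (i : ℕ) {N : ℕ} (hN : 0 < N)
    (hx : ∀ v, ∀ z ∈ X₀, prepend (x v) i N z ∈ X₀) (ω : ℕ → ι) :
    concatWords x i N ω ∈ X₀ := by
  have key : ∀ K : ℕ, ∀ ω : ℕ → ι, ∃ z ∈ X₀, ∀ l < K * N, concatWords x i N ω l = z l := by
    intro K
    induction K with
    | zero =>
      intro ω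
      obtain ⟨z, hz⟩ := hne
      exact ⟨z, hz, fun l hl => by simp at hl⟩
    | succ K ih =>
      intro ω
      obtain ⟨z, hz, hl⟩ := ih fun k => ω (k + 1)
      refine ⟨_, hx (ω 0) z hz, fun l hlK => ?_⟩
      by_cases h : l < N
      · have := concatWords_apply x i ω 0 h
        simp only [zero_mul, zero_add] at this
        simp only [prepend, h, if_true, this]
      · push Not at h
        obtain ⟨l, rfl⟩ := Nat.exists_eq_add_of_le' h
        rw [add_mul, one_mul, add_lt_add_iff_right] at hlK
        have h1 := hl l hlK
        simp only [prepend, not_lt.2 h, if_false, Nat.add_sub_cancel]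
        rw [← h1]
        simp only [concatWords, Nat.add_div_right _ hN, Nat.add_mod_right]
  refine mem_of_forall_prefix hcl fun n => ?_
  obtain ⟨z, hz, hl⟩ := key n ω
  exact ⟨z, hz, fun l hln => hl l (hln.trans_le (Nat.le_mul_of_pos_right n hN))⟩

theorem birkhoffSum_mul_le {α : Type*} (T : α → α) (f : α → ℝ) (N : ℕ) (x : α) {C : ℝ}
    (h : ∀ k, birkhoffSum T f N (T^[k * N] x) ≤ C) (M : ℕ) :
    birkhoffSum T f (M * N) x ≤ M * C := by
  induction M with
  | zero => simp
  | succ M ih =>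
    rw [add_mul, one_mul, birkhoffSum_add]
    push_cast
    linarith [h M]

/-- Absorbs the losses from pigeonholing over cut points and over values of Birkhoff sums. -/
theorem eventually_poly_le_exp (c : ℝ) (k : ℕ) {ε : ℝ} (hε : 0 < ε) :
    ∀ᶠ n : ℕ in atTop, c * ((n : ℝ) + k + 1) ^ 2 ≤ Real.exp (ε * n) := by
  have h1 : Tendsto (fun x : ℝ => (x + k + 1) ^ 2 * Real.exp (-(ε * (x + k + 1)))) atTop (𝓝 0) := by
    have h0 := Real.tendsto_pow_mul_exp_neg_atTop_nhds_zero 2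
    have h2 : Tendsto (fun x : ℝ => ε * (x + k + 1)) atTop atTop :=
      ((tendsto_atTop_add_const_right _ _
        (tendsto_atTop_add_const_right _ _ tendsto_id))).const_mul_atTop hε
    have h3 := (h0.comp h2).const_mul (ε ^ 2)⁻¹
    simp only [mul_zero] at h3
    refine h3.congr fun x => ?_
    simp only [Function.comp]
    field_simp
  have h2 := (h1.comp tendsto_natCast_atTop_atTop).const_mul (|c| * Real.exp (ε * (k + 1)))
  simp only [mul_zero] at h2
  filter_upwards [h2.eventually (gt_mem_nhds one_pos)] with n hn
  simp only [Function.comp] at hn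
  have h3 : Real.exp (ε * (k + 1)) * Real.exp (-(ε * (n + k + 1))) = Real.exp (-(ε * n)) := by
    rw [← Real.exp_add]; ring_nf
  have h4 : |c| * ((n : ℝ) + k + 1) ^ 2 * Real.exp (-(ε * n)) ≤ 1 := by
    rw [← h3]; linarith
  rw [Real.exp_neg, ← div_eq_mul_inv, div_le_one (Real.exp_pos _)] at h4
  exact (mul_le_mul_of_nonneg_right (le_abs_self c) (by positivity)).trans h4

variable {p q : ℕ} {X : Set (SymSeq p)} {Y : Set (SymSeq q)}

/-- A subexponential loss of points makes them distinguishable in a common window of freely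
concatenable words. -/
theorem exists_uniform_window {π : SymSeq p → SymSeq q} (hY : π '' X = Y) {m : ℕ}
    (hwin : ∀ x ∈ X, ∀ y ∈ X, ∀ a b : ℕ, (∀ l < m, x (a + l) = y (b + l)) → π x a = π y b)
    {X₀ : Set (SymSeq p)} {c d : ℕ → Fin p}
    (hdec : ∀ x ∈ X, ∀ n : ℕ, ∃ i j : ℕ,
      i ≤ j ∧ j ≤ n ∧ (∀ l < i, x l = c l) ∧ (∀ l, j ≤ l → l < n → x l = d (l - j)) ∧
        ∀ z ∈ X₀, prepend x i (j - i) z ∈ X₀)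
    (n : ℕ) (V : Finset (SymSeq q)) (hV : ∀ y ∈ V, y ∈ Y)
    (hdist : ∀ y ∈ V, ∀ y' ∈ V, (∀ l < n, y l = y' l) → y = y') :
    ∃ W ⊆ V, (V.card : ℝ) ≤ ((q : ℝ) ^ m * (q : ℝ) ^ m) * ((n : ℝ) + m + 1) ^ 2 * W.card ∧
      ∃ (x : SymSeq q → SymSeq p) (i N : ℕ), i + N ≤ n + m ∧
        (∀ y ∈ W, x y ∈ X ∧ π (x y) = y ∧ ∀ z ∈ X₀, prepend (x y) i N z ∈ X₀) ∧
        ∀ y ∈ W, ∀ y' ∈ W, (∀ l, l + m ≤ N → y (i + l) = y' (i + l)) → y = y' := by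
  classical
  have h1 : ∀ y : SymSeq q, ∃ (x : SymSeq p) (i j : ℕ), y ∈ V → (x ∈ X ∧ π x = y) ∧
      i ≤ j ∧ j ≤ n + m ∧ (∀ l < i, x l = c l) ∧
      (∀ l, j ≤ l → l < n + m → x l = d (l - j)) ∧ ∀ z ∈ X₀, prepend x i (j - i) z ∈ X₀ := by
    intro y
    by_cases hy : y ∈ V
    · have := hV y hy
      rw [← hY] at this
      obtain ⟨x, hx, hxy⟩ := this
      -- Length n + m, so that the coding window of every position below n lies in the decomposed
      -- word.
      obtain ⟨i, j, h⟩ := hdec x hx (n + m)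
      exact ⟨x, i, j, fun _ => ⟨⟨hx, hxy⟩, h⟩⟩
    · rcases V.eq_empty_or_nonempty with rfl | ⟨y', hy'⟩
      · exact ⟨fun _ => c 0, 0, 0, fun h => absurd h hy⟩
      · exact ⟨fun _ => c 0, 0, 0, fun h => absurd h hy⟩
  choose x I J hx using h1
  -- Besides the two cuts, the key records the m letters of y before each cut: a coding window there
  -- may straddle the cut, so neither the fixed sequences nor the middle word determines the letter.
  let κ : SymSeq q → (Fin (n + m + 1) × Fin (n + m + 1)) × (Fin m → Fin q) × (Fin m → Fin q) :=
    fun y => ((Fin.ofNat _ (I y), Fin.ofNat _ (J y)),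
      (fun l => y (I y - m + l)), (fun l => y (J y - m + l)))
  have hcard : ((Finset.univ : Finset ((Fin (n + m + 1) × Fin (n + m + 1)) ×
      (Fin m → Fin q) × (Fin m → Fin q))).card : ℝ)
      = ((q : ℝ) ^ m * (q : ℝ) ^ m) * ((n : ℝ) + m + 1) ^ 2 := by
    simp [Fintype.card_prod]
    ring
  rcases V.eq_empty_or_nonempty with rfl | hVne
  · exact ⟨∅, Finset.empty_subset _, by simp, fun _ _ => c 0, 0, 0, by omega, by simp, by simp⟩
  obtain ⟨y₀, hy₀⟩ := hVne
  have hK : (0 : ℝ) < ((q : ℝ) ^ m * (q : ℝ) ^ m) * ((n : ℝ) + m + 1) ^ 2 := by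
    have : 0 < q := Fin.pos (y₀ 0)
    have : (0 : ℝ) < q := by exact_mod_cast this
    positivity
  obtain ⟨key, -, hkey⟩ := Finset.exists_le_card_fiber_of_nsmul_le_card_of_maps_to
    (s := V) (t := Finset.univ) (f := κ) (fun _ _ => Finset.mem_univ _)
    ⟨κ y₀, Finset.mem_univ _⟩
    (b := (V.card : ℝ) / (((q : ℝ) ^ m * (q : ℝ) ^ m) * ((n : ℝ) + m + 1) ^ 2)) (by
      rw [nsmul_eq_mul, hcard, mul_div_cancel₀ _ hK.ne'])
  rw [div_le_iff₀ hK] at hkey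
  set W := {y ∈ V | κ y = key} with hW
  have hWV : W ⊆ V := Finset.filter_subset _ _
  rcases W.eq_empty_or_nonempty with hW0 | ⟨y₁, hy₁⟩
  · refine ⟨W, hWV, by linarith, fun _ _ => c 0, 0, 0, by omega, ?_, ?_⟩ <;> simp [hW0]
  have hI : ∀ y ∈ V, I y < n + m + 1 ∧ J y < n + m + 1 := fun y hy => by
    have := hx y hy
    omega
  have hIJ : ∀ y ∈ W, I y = I y₁ ∧ J y = J y₁ ∧ (∀ l < m, y (I y₁ - m + l) = y₁ (I y₁ - m + l)) ∧
      ∀ l < m, y (J y₁ - m + l) = y₁ (J y₁ - m + l) := by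
    intro y hy
    have h2 : κ y = κ y₁ := (Finset.mem_filter.1 hy).2.trans (Finset.mem_filter.1 hy₁).2.symm
    simp only [κ, Prod.mk.injEq] at h2
    obtain ⟨⟨hi, hj⟩, hu, hv⟩ := h2
    have hi' := congrArg Fin.val hi
    have hj' := congrArg Fin.val hj
    simp only [Fin.ofNat] at hi' hj'
    have hyV := hI y (hWV hy)
    have hy₁V := hI y₁ (hWV hy₁)
    rw [Nat.mod_eq_of_lt hyV.1, Nat.mod_eq_of_lt hy₁V.1] at hi'
    rw [Nat.mod_eq_of_lt hyV.2, Nat.mod_eq_of_lt hy₁V.2] at hj'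
    rw [hi'] at hu
    rw [hj'] at hv
    exact ⟨hi', hj', fun l hl => congrFun hu ⟨l, hl⟩, fun l hl => congrFun hv ⟨l, hl⟩⟩
  have hx₁ := hx y₁ (hWV hy₁)
  refine ⟨W, hWV, by linarith, x, I y₁, J y₁ - I y₁, by omega, fun y hy => ?_,
    fun y hy y' hy' hyy' => hdist y (hWV hy) y' (hWV hy') fun l hl => ?_⟩
  · have h := hx y (hWV hy)
    rw [(hIJ y hy).1, (hIJ y hy).2.1] at h
    exact ⟨h.1.1, h.1.2, h.2.2.2.2.2⟩
  · have h := hx y (hWV hy)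
    have h' := hx y' (hWV hy')
    have hk := hIJ y hy
    have hk' := hIJ y' hy'
    rw [hk.1, hk.2.1] at h
    rw [hk'.1, hk'.2.1] at h'
    obtain ⟨⟨hxX, hxy⟩, -, -, hc, hd, -⟩ := h
    obtain ⟨⟨hxX', hxy'⟩, -, -, hc', hd', -⟩ := h'
    -- The coding window of l lies in the common prefix, straddles the first cut, lies in the middle
    -- word, straddles the second cut, or lies in the common suffix.
    by_cases c1 : l + m ≤ I y₁
    · rw [← hxy, ← hxy']
      exact hwin _ hxX _ hxX' l l fun s hs =>
        (hc _ (by omega)).trans (hc' _ (by omega)).symm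
    by_cases c2 : l < I y₁
    · have := (hk.2.2.1 (l - (I y₁ - m)) (by omega)).trans
        (hk'.2.2.1 (l - (I y₁ - m)) (by omega)).symm
      rwa [show I y₁ - m + (l - (I y₁ - m)) = l by omega] at this
    by_cases c3 : l + m ≤ J y₁
    · have := hyy' (l - I y₁) (by omega)
      rwa [show I y₁ + (l - I y₁) = l by omega] at this
    by_cases c4 : l < J y₁
    · have := (hk.2.2.2 (l - (J y₁ - m)) (by omega)).trans
        (hk'.2.2.2 (l - (J y₁ - m)) (by omega)).symm
      rwa [show J y₁ - m + (l - (J y₁ - m)) = l by omega] at this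
    · rw [← hxy, ← hxy']
      exact hwin _ hxX _ hxX' l l fun s hs =>
        (hd _ (by omega) (by omega)).trans (hd' _ (by omega) (by omega)).symm

/-- Compares the Birkhoff sum over one block with that over the original orbit segment: all but the
last L terms are matched up to δ, the last L cost at most F each, and nonnegativity of v allows
extending to the whole segment. -/
theorem sum_window_le {N L n i : ℕ} (hi : i + (N - L) ≤ n ∨ N ≤ L) {u v : ℕ → ℝ} {δ F : ℝ}
    (hδ : 0 ≤ δ) (hF : 0 ≤ F) (hv : ∀ s < n, 0 ≤ v s) (huF : ∀ r < N, u r ≤ F)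
    (huv : ∀ r, r + L ≤ N → r < N → u r ≤ v (i + r) + δ) :
    ∑ r ∈ Finset.range N, u r ≤ ∑ s ∈ Finset.range n, v s + N * δ + L * F := by
  have hsv : 0 ≤ ∑ s ∈ Finset.range n, v s :=
    Finset.sum_nonneg fun s hs => hv s (Finset.mem_range.1 hs)
  rcases le_or_gt N L with hNL | hNL
  · have h1 : ∑ r ∈ Finset.range N, u r ≤ N * F := by
      refine (Finset.sum_le_sum fun r hr => huF r (Finset.mem_range.1 hr)).trans_eq ?_
      simp
    have h2 : (N : ℝ) * F ≤ L * F := mul_le_mul_of_nonneg_right (by exact_mod_cast hNL) hF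
    have h3 : 0 ≤ (N : ℝ) * δ := by positivity
    linarith
  · have hi' : i + (N - L) ≤ n := hi.resolve_right (not_le.2 hNL)
    have hN : N = (N - L) + L := by omega
    have h0 : ∑ r ∈ Finset.range N, u r
        = ∑ r ∈ Finset.range (N - L), u r + ∑ r ∈ Finset.range L, u (N - L + r) := by
      conv_lhs => rw [hN, Finset.sum_range_add]
    have h1 : ∑ r ∈ Finset.range L, u (N - L + r) ≤ L * F := by
      refine (Finset.sum_le_sum fun r hr => huF _ ?_).trans_eq (by simp : ∑ r ∈ Finset.range L, F = L * F)
      have := Finset.mem_range.1 hr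
      omega
    have h2 : ∑ r ∈ Finset.range (N - L), u r
        ≤ ∑ r ∈ Finset.range (N - L), v (i + r) + N * δ := by
      have : ∑ r ∈ Finset.range (N - L), u r ≤ ∑ r ∈ Finset.range (N - L), (v (i + r) + δ) :=
        Finset.sum_le_sum fun r hr => huv r (by have := Finset.mem_range.1 hr; omega)
          (by have := Finset.mem_range.1 hr; omega)
      rw [Finset.sum_add_distrib, Finset.sum_const, Finset.card_range, nsmul_eq_mul] at this
      have h3 : ((N - L : ℕ) : ℝ) * δ ≤ N * δ :=
        mul_le_mul_of_nonneg_right (by exact_mod_cast Nat.sub_le _ _) hδ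
      linarith
    have h3 : ∑ r ∈ Finset.range (N - L), v (i + r) ≤ ∑ s ∈ Finset.range n, v s := by
      obtain ⟨e, rfl⟩ := Nat.exists_eq_add_of_le hi'
      rw [Finset.sum_range_add, Finset.sum_range_add]
      have h4 : 0 ≤ ∑ s ∈ Finset.range i, v s :=
        Finset.sum_nonneg fun s hs => hv s (by have := Finset.mem_range.1 hs; omega)
      have h5 : 0 ≤ ∑ s ∈ Finset.range e, v (i + (N - L) + s) :=
        Finset.sum_nonneg fun s hs => hv _ (by have := Finset.mem_range.1 hs; omega)
      linarith
    linarith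

/-- Exponentially many orbit segments with small Birkhoff sums yield a free concatenation system
with the same growth rate. -/
theorem exists_horseshoe (hX : IsCompact X) (hinv : MapsTo shift X X) (hdec : IsDecomposable X)
    {π : SymSeq p → SymSeq q} (hπ : ContinuousOn π X) (hY : π '' X = Y)
    (hcomm : ∀ x ∈ X, π (shift x) = shift (π x)) (hYinv : MapsTo shift Y Y)
    {f : SymSeq q → ℝ} (hf : ContinuousOn f Y) (hf0 : ∀ y ∈ Y, 0 ≤ f y) {t ε : ℝ} (ht : 0 < t)
    (hε : 0 < ε)
    (hgrowth : ∃ᶠ n : ℕ in atTop, ∃ (V : Finset (SymSeq q)) (a : ℝ), 0 ≤ a ∧ (∀ y ∈ V, y ∈ Y) ∧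
      (∀ y ∈ V, ∀ y' ∈ V, (∀ l < n, y l = y' l) → y = y') ∧
      Real.exp ((t * (1 + a) + ε) * n) ≤ V.card ∧ ∀ y ∈ V, birkhoffSum shift f n y ≤ a * n) :
    ∃ (N b m : ℕ) (a : ℝ) (Θ : (ℕ → Fin b) → SymSeq q), 0 < N ∧ 0 ≤ a ∧ (∀ ω, Θ ω ∈ Y) ∧
      (∀ ω ω' k, (∀ l < (k + 1) * N, Θ ω l = Θ ω' l) → ω k = ω' k) ∧
      (∀ ω M r, (∀ i < r, ω (M + i) = ω i) →
        ∀ l, l + m ≤ r * N → Θ ω (M * N + l) = Θ ω l) ∧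
      t * (N * (1 + a)) < Real.log b ∧
      ∀ ω M, birkhoffSum shift f (M * N) (Θ ω) ≤ M * (a * N - 1) := by
  obtain ⟨X₀, hX₀, hne, hcl, c, d, hdec⟩ := hdec
  obtain ⟨m, hwin⟩ := exists_window hX hinv hπ hcomm
  have hYc : IsCompact Y := hY ▸ hX.image_of_continuousOn hπ
  obtain ⟨F, hF0, hF⟩ : ∃ F : ℝ, 0 ≤ F ∧ ∀ y ∈ Y, f y ≤ F := by
    obtain ⟨F, hF⟩ := hYc.bddAbove_image hf
    exact ⟨max F 0, le_max_right _ _, fun y hy => (hF ⟨y, hy, rfl⟩).trans (le_max_left _ _)⟩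
  -- Budget for ε: half pays for the polynomial factor, a quarter for the error δ per letter (tδ =
  -- ε/4), a quarter for the bounded terms.
  set δ := ε / (4 * t) with hδ
  have hδ0 : 0 < δ := by positivity
  obtain ⟨ℓ, hℓ⟩ := exists_prefix_dist_lt hYc hf hδ0
  -- The last m + ℓ letters of a block see the next block, so `f` is only bounded by F there. The
  -- extra 1 gives each block a unit gain, which later outweighs the fixed loss m in the return
  -- length.
  set D : ℝ := ((m + ℓ : ℕ) : ℝ) * F + 1 with hD
  have hD0 : 0 ≤ D := by positivity
  have hlin : ∀ᶠ n : ℕ in atTop, t * (m + δ * m + D) < ε / 4 * n := by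
    have := (tendsto_natCast_atTop_atTop (R := ℝ)).const_mul_atTop (show 0 < ε / 4 by positivity)
    exact this.eventually_gt_atTop _
  obtain ⟨n, ⟨V, a, ha, hVY, hVd, hVcard, hVf⟩, hlin, hpoly, hn0⟩ :=
    (hgrowth.and_eventually (hlin.and ((eventually_poly_le_exp ((q : ℝ) ^ m * (q : ℝ) ^ m) m
      (half_pos hε)).and (eventually_gt_atTop 0)))).exists
  obtain ⟨W, hWV, hWcard, x, i, N, hiN, hxW, hWinj⟩ :=
    exists_uniform_window hY hwin hdec n V hVY hVd
  have hn0' : (0 : ℝ) < n := by exact_mod_cast hn0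
  have hWexp : Real.exp ((t * (1 + a) + ε / 2) * n) ≤ W.card := by
    have h1 : Real.exp ((t * (1 + a) + ε) * n)
        = Real.exp (ε / 2 * n) * Real.exp ((t * (1 + a) + ε / 2) * n) := by
      rw [← Real.exp_add]; ring_nf
    have h2 : Real.exp (ε / 2 * n) * Real.exp ((t * (1 + a) + ε / 2) * n)
        ≤ Real.exp (ε / 2 * n) * W.card := by
      rw [← h1]
      exact hVcard.trans (hWcard.trans (mul_le_mul_of_nonneg_right hpoly (by positivity)))
    exact le_of_mul_le_mul_left h2 (Real.exp_pos _)
  have hW1 : 1 < W.card := by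
    have : (1 : ℝ) < W.card := lt_of_lt_of_le (Real.one_lt_exp_iff.2 (by positivity)) hWexp
    exact_mod_cast this
  obtain ⟨N0⟩ : Nonempty (0 < N) := by
    by_contra hN
    simp only [nonempty_prop, not_lt, Nat.le_zero] at hN
    obtain ⟨y, hy, y', hy', hyy'⟩ := Finset.one_lt_card.1 hW1
    refine hyy' (hWinj y hy y' hy' fun l hl => ?_)
    -- With N = 0, the inequality l + m ≤ N leaves only m = 0; the code then has an empty window and
    -- is constant.
    have hm : m = 0 := by omega
    have h1 := hxW y hy
    have h2 := hxW y' hy'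
    rw [← h1.2.1, ← h2.2.1]
    exact hwin _ h1.1 _ h2.1 _ _ fun s hs => by omega
  let e := W.equivFin.symm
  set ξ : (ℕ → Fin W.card) → SymSeq p := concatWords (fun v => x (e v)) i N with hξ
  have hξX : ∀ ω, ξ ω ∈ X := fun ω => hX₀ (concatWords_mem hne hcl _ i N0
    (fun v z hz => (hxW _ (e v).2).2.2 z hz) ω)
  have hblock : ∀ ω k r, r + m ≤ N → r < N → π (ξ ω) (k * N + r) = (e (ω k) : SymSeq q) (i + r) := by
    intro ω k r hr _
    conv_rhs => rw [← (hxW _ (e (ω k)).2).2.1]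
    refine hwin _ (hξX ω) _ (hxW _ (e (ω k)).2).1 _ _ fun l hl => ?_
    rw [add_assoc, hξ, concatWords_apply _ _ _ _ (show r + l < N by omega), add_assoc]
  have hN0' : (0 : ℝ) < N := by exact_mod_cast N0
  -- The new ratio is the bound on S_n f, with its errors, per letter of the shorter block. Hence
  -- N(1 + ratio) = N + an + Nδ + D, still close to n(1 + a) from above.
  refine ⟨N, W.card, m, (a * n + N * δ + D) / N, fun ω => π (ξ ω), N0, by positivity,
    fun ω => hY ▸ ⟨_, hξX ω, rfl⟩, fun ω ω' k hl => ?_, fun ω M r hr l hl => ?_, ?_,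
    fun ω M => ?_⟩
  · have : (e (ω k) : SymSeq q) = e (ω' k) := by
      refine hWinj _ (e (ω k)).2 _ (e (ω' k)).2 fun l hl' => ?_
      rcases Nat.lt_or_ge l N with hlN | hlN
      · rw [← hblock ω k l hl' hlN, ← hblock ω' k l hl' hlN]
        exact hl _ (by rw [add_mul, one_mul]; omega)
      · have h1 := hxW _ (e (ω k)).2
        have h2 := hxW _ (e (ω' k)).2
        rw [← h1.2.1, ← h2.2.1]
        exact hwin _ h1.1 _ h2.1 _ _ fun s hs => by omega
    exact e.injective (Subtype.ext this)
  · refine hwin _ (hξX ω) _ (hξX ω) _ _ fun s hs => ?_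
    have hlt : l + s < r * N := by omega
    have h1 : l + s = (l + s) / N * N + (l + s) % N := by
      rw [mul_comm]; exact (Nat.div_add_mod _ _).symm
    have h2 : (l + s) / N < r := Nat.div_lt_of_lt_mul (by rwa [mul_comm])
    rw [add_assoc, h1, ← add_assoc, ← add_mul, hξ,
      concatWords_apply _ _ _ _ (Nat.mod_lt _ N0), concatWords_apply _ _ _ _ (Nat.mod_lt _ N0),
      hr _ h2]
  · have h1 : (t * (1 + a) + ε / 2) * n ≤ Real.log W.card := by
      rw [Real.le_log_iff_exp_le (by exact_mod_cast one_pos.trans hW1)]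
      exact hWexp
    refine lt_of_lt_of_le ?_ h1
    have h2 : (N : ℝ) ≤ n + m := by
      have : N ≤ n + m := by omega
      exact_mod_cast this
    have h3 : t * (N * (1 + (a * n + N * δ + D) / N)) = t * (N + a * n + N * δ + D) := by
      field_simp
      ring
    have h4 : t * δ = ε / 4 := by rw [hδ]; field_simp
    rw [h3]
    calc t * (N + a * n + N * δ + D) ≤ t * ((n + m) + a * n + (n + m) * δ + D) := by
          have : (N : ℝ) * δ ≤ (n + m) * δ := mul_le_mul_of_nonneg_right h2 hδ0.le
          exact mul_le_mul_of_nonneg_left (by linarith) ht.le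
      _ = t * (1 + a) * n + (t * δ) * n + t * (m + δ * m + D) := by ring
      _ < (t * (1 + a) + ε / 2) * n := by rw [h4]; linarith
  · refine birkhoffSum_mul_le _ _ _ _ (fun k => ?_) M
    have hya := hVf _ (hWV (e (ω k)).2)
    have hyY := hVY _ (hWV (e (ω k)).2)
    have hΘY : π (ξ ω) ∈ Y := hY ▸ ⟨_, hξX ω, rfl⟩
    have h := sum_window_le (N := N) (L := m + ℓ) (n := n) (i := i)
      (u := fun r => f (shift^[r] (shift^[k * N] (π (ξ ω)))))
      (v := fun s => f (shift^[s] (e (ω k) : SymSeq q))) (by omega) hδ0.le hF0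
      (fun s _ => hf0 _ (shift_iterate_mem hYinv hyY s))
      (fun r _ => hF _ (shift_iterate_mem hYinv (shift_iterate_mem hYinv hΘY _) _))
      (fun r hr hrN => by
        have h1 := hℓ _ (shift_iterate_mem hYinv (shift_iterate_mem hYinv hΘY (k * N)) r) _
          (shift_iterate_mem hYinv hyY (i + r)) (fun s hs => by
            rw [shift_iterate_apply, shift_iterate_apply, shift_iterate_apply,
              show s + r + k * N = k * N + (s + r) by ring,
              hblock ω k (s + r) (by omega) (by omega)]
            rw [Nat.add_left_comm])
        rw [Real.dist_eq] at h1
        linarith [(abs_lt.1 h1).2])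
    have h2 : (a * n + N * δ + D) / N * N - 1 = a * n + N * δ + ((m + ℓ : ℕ) : ℝ) * F := by
      rw [div_mul_cancel₀ _ hN0'.ne', hD]; ring
    rw [h2]
    exact h.trans (by simp only [birkhoffSum] at hya; linarith)

end Horseshoe

/-! ### The S-gap and β-shifts are decomposable. -/

section Examples

variable {p : ℕ}

theorem toLex_le_iff (x w : SymSeq p) :
    toLex (α := ℕ → Fin p) x ≤ toLex (α := ℕ → Fin p) w ↔
      ∀ k, (∀ l < k, x l = w l) → x k ≤ w k := by
  rw [← not_lt]
  constructor
  · intro h k hk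
    by_contra! hlt
    exact h ⟨k, fun l hl => (hk l hl).symm, hlt⟩
  · rintro h ⟨k, hk, hlt⟩
    exact absurd (h k fun l hl => (hk l hl).symm) (not_le.2 hlt)

theorem mem_lexShift_iff {w x : SymSeq p} :
    x ∈ lexShift w ↔ ∀ j k, (∀ l < k, x (l + j) = w l) → x (k + j) ≤ w k := by
  refine forall_congr' fun j => ?_
  rw [toLex_le_iff]
  simp only [shift_iterate_apply]

theorem isClosed_lexShift (w : SymSeq p) : IsClosed (lexShift w) := by
  refine isClosed_of_prefix fun x hx => mem_lexShift_iff.2 fun j k hl => ?_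
  obtain ⟨y, hy, hyx⟩ := hx (k + j + 1)
  rw [← hyx _ (Nat.lt_succ_self _)]
  refine mem_lexShift_iff.1 hy j k fun l hlk => ?_
  rw [hyx _ (by omega), hl l hlk]

theorem mapsTo_shift_lexShift (w : SymSeq p) : MapsTo shift (lexShift w) (lexShift w) :=
  fun _ hx j => by
    rw [← Function.iterate_succ_apply]
    exact hx (j + 1)

/-- Cut off the longest suffix that is a prefix of `w`. In what remains, no comparison with `w` is
still tied at the cut, so any admissible continuation is harmless. -/
theorem isDecomposable_lexShift {w : SymSeq p} (hw : w ∈ lexShift w) :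
    IsDecomposable (lexShift w) := by
  classical
  refine ⟨lexShift w, Subset.rfl, ⟨w, hw⟩, isClosed_lexShift w, w, w, fun x hx n => ?_⟩
  have hex : ∃ i, ∀ l, i ≤ l → l < n → x l = w (l - i) := ⟨n, fun l h1 h2 => by omega⟩
  set i := Nat.find hex with hi
  have hispec := Nat.find_spec hex
  rw [← hi] at hispec
  have hin : i ≤ n := Nat.find_min' hex fun l h1 h2 => by omega
  refine ⟨0, i, Nat.zero_le _, hin, fun l hl => by omega, hispec, fun z hz => ?_⟩
  rw [mem_lexShift_iff] at hx hz hw ⊢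
  intro j k hjk
  simp only [prepend, zero_add, Nat.sub_zero] at hjk ⊢
  by_cases hji : i ≤ j
  · rw [if_neg (by omega), show k + j - i = k + (j - i) by omega]
    refine hz _ _ fun l hl => ?_
    rw [← hjk l hl, if_neg (by omega), show l + j - i = l + (j - i) by omega]
  push Not at hji
  by_cases hkj : k + j < i
  · rw [if_pos hkj]
    refine hx _ _ fun l hl => ?_
    rw [← hjk l hl, if_pos (by omega)]
  exfalso
  -- A tie from j to the cut i would extend to n: admissibility of x gives ≤, while past the cut x
  -- follows `w` from its start and admissibility of `w` gives ≥. So the suffix from j < i would be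
  -- a prefix of `w`, against minimality of i.
  have hall : ∀ l, l + j < n → x (l + j) = w l := by
    intro l
    induction l using Nat.strong_induction_on with
    | _ l ih =>
      intro hl
      by_cases hli : l + j < i
      · rw [← hjk l (by omega), if_pos hli]
      · refine le_antisymm (hx j l fun l' hl' => ih l' hl' (by omega)) ?_
        rw [hispec _ (by omega) hl]
        have h1 := hw (i - j) (l + j - i) fun l' hl' => by
          rw [← ih (l' + (i - j)) (by omega) (by omega), hispec _ (by omega) (by omega)]
          congr 1
          omega
        rwa [show l + j - i + (i - j) = l by omega] at h1
  refine Nat.find_min hex hji fun l h1 h2 => ?_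
  have := hall (l - j) (by omega)
  rwa [show l - j + j = l by omega] at this

/-- Expansions produced by a monotone digit rule are lexicographically maximal among their shifts
as soon as the initial remainder is the largest one. -/
theorem mem_lexShift_self_of_digits {w : SymSeq p} {β : ℝ} (hβ : 0 ≤ β) (r : ℕ → ℝ) (D : ℝ → ℕ)
    (hD : Monotone D) (hw : ∀ n, (w n : ℕ) = D (r n)) (hr : ∀ n, r (n + 1) = β * r n - D (r n))
    (hmax : ∀ n, r n ≤ r 0) : w ∈ lexShift w := by
  rw [mem_lexShift_iff]
  intro j k hjk
  have h : ∀ l ≤ k, r (l + j) ≤ r l := by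
    intro l
    induction l with
    | zero => intro _; rw [zero_add]; exact hmax j
    | succ l ih =>
      intro hl
      have h1 : D (r (l + j)) = D (r l) := by
        rw [← hw, ← hw, hjk l hl]
      rw [show l + 1 + j = (l + j) + 1 by omega, hr, hr, h1]
      linarith [mul_le_mul_of_nonneg_left (ih (by omega)) hβ]
  rw [Fin.le_def, hw, hw]
  exact hD (h k le_rfl)

theorem greedyRemainder_le_one {β : ℝ} (hβ : 1 < β) (n : ℕ) : greedyRemainder β n ≤ 1 := by
  induction n with
  | zero => exact le_rfl
  | succ n ih =>
    simp only [greedyRemainder]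
    rcases min_choice ⌊β * greedyRemainder β n⌋₊ (⌈β⌉₊ - 1) with h | h
    · rw [h]
      linarith [Nat.lt_floor_add_one (β * greedyRemainder β n)]
    · rw [h, Nat.cast_sub (ceil_pos_of_one_lt hβ)]
      have h1 := Nat.le_ceil β
      have h2 : β * greedyRemainder β n ≤ β * 1 := mul_le_mul_of_nonneg_left ih (by linarith)
      push_cast
      linarith

theorem greedyExpansion_mem {β : ℝ} (hβ : 1 < β) :
    greedyExpansion β hβ ∈ lexShift (greedyExpansion β hβ) :=
  mem_lexShift_self_of_digits (β := β) (by linarith) (greedyRemainder β)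
    (fun r => min ⌊β * r⌋₊ (⌈β⌉₊ - 1))
    (fun a b hab => min_le_min_right _ (Nat.floor_mono
      (mul_le_mul_of_nonneg_left hab (by linarith))))
    (fun _ => rfl) (fun _ => rfl) (greedyRemainder_le_one hβ)

theorem quasiGreedyExpansion_mem {β : ℝ} (hβ : 1 < β) :
    quasiGreedyExpansion β hβ ∈ lexShift (quasiGreedyExpansion β hβ) :=
  mem_lexShift_self_of_digits (β := β) (by linarith) (quasiGreedyRemainder β)
    (fun r => ⌈β * r⌉₊ - 1)
    (fun a b hab => Nat.sub_le_sub_right (Nat.ceil_mono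
      (mul_le_mul_of_nonneg_left hab (by linarith))) 1)
    (fun _ => rfl) (fun _ => rfl) (fun n => (quasiGreedyRemainder_mem hβ n).2)

theorem isClosed_sGapShift (S : Set ℕ) : IsClosed (sGapShift S) := by
  refine isClosed_of_prefix fun x hx i n h1 h2 h3 => ?_
  obtain ⟨y, hy, hyx⟩ := hx (i + n + 2)
  refine hy i n ?_ ?_ fun k hk => ?_
  · rw [hyx _ (by omega), h1]
  · rw [hyx _ (by omega), h2]
  · rw [hyx _ (by omega), h3 k hk]

theorem mapsTo_shift_sGapShift (S : Set ℕ) : MapsTo shift (sGapShift S) (sGapShift S) := by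
  intro x hx i n h1 h2 h3
  simp only [shift] at h1 h2 h3
  refine hx (i + 1) n h1 ?_ fun k hk => ?_
  · rw [← h2]; congr 1; omega
  · rw [← h3 k hk]; congr 1; omega

/-- Cut at the first and the last 1 of the word: zeros come before, 10⋯0 after, and the middle
begins with 1 and stops just before a 1. Followed by a sequence starting with 1, it creates no new
gap. A word without 1 is all prefix. -/
theorem isDecomposable_sGapShift (S : Set ℕ) : IsDecomposable (sGapShift S) := by
  classical
  have h01 : ∀ a : Fin 2, a ≠ 1 → a = 0 := by decide
  refine ⟨{x | x ∈ sGapShift S ∧ x 0 = 1}, fun x hx => hx.1,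
    ⟨fun l => if l = 0 then 1 else 0, ?_, rfl⟩, ?_, fun _ => 0,
    fun l => if l = 0 then 1 else 0, fun x hx n => ?_⟩
  · intro i n _ h2 _
    simp at h2
  · refine isClosed_of_prefix fun x hx => ⟨?_, ?_⟩
    · refine mem_of_forall_prefix (isClosed_sGapShift S) fun n => ?_
      obtain ⟨y, hy, h⟩ := hx n
      exact ⟨y, hy.1, fun l hl => (h l hl).symm⟩
    · obtain ⟨y, hy, h⟩ := hx 1
      rw [← h 0 one_pos]
      exact hy.2
  · by_cases hex : ∃ l, l < n ∧ x l = 1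
    · set i := Nat.find hex with hi
      obtain ⟨hin, hxi⟩ := Nat.find_spec hex
      rw [← hi] at hin hxi
      set j := Nat.findGreatest (fun l => l < n ∧ x l = 1) n with hj
      have hjspec : j < n ∧ x j = 1 :=
        Nat.findGreatest_spec (P := fun l => l < n ∧ x l = 1) hin.le ⟨hin, hxi⟩
      have hij : i ≤ j := Nat.le_findGreatest hin.le ⟨hin, hxi⟩
      refine ⟨i, j, hij, hjspec.1.le, fun l hl => h01 _ fun h =>
        Nat.find_min hex hl ⟨by omega, h⟩, fun l h1 h2 => ?_, fun z hz => ⟨?_, ?_⟩⟩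
      · change x l = if l - j = 0 then 1 else 0
        rcases h1.eq_or_lt with h1 | h1
        · rw [← h1, Nat.sub_self, if_pos rfl]
          exact hjspec.2
        · rw [if_neg (Nat.sub_ne_zero_of_lt h1)]
          exact h01 _ fun h => Nat.findGreatest_is_greatest h1 h2.le ⟨h2, h⟩
      · intro a g h1 h2 h3
        by_cases c1 : j - i ≤ a
        · simp only [prepend] at h1 h2 h3
          rw [if_neg (by omega)] at h1 h2
          refine hz.1 _ g h1 ?_ fun k hk => ?_
          · rw [← h2]; congr 1; omega
          · have := h3 k hk
            rw [if_neg (by omega)] at this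
            rw [← this]; congr 1; omega
        -- A gap that starts in the prepended word ends no later than the junction, where both z and
        -- x have a 1; it is therefore a gap of x.
        have hend : x (i + (a + g + 1)) = 1 ∧ a + g + 1 ≤ j - i := by
          by_cases c2 : a + g + 1 < j - i
          · simp only [prepend, c2, if_true] at h2
            exact ⟨h2, c2.le⟩
          · rcases (not_lt.1 c2).eq_or_lt with h | h
            · rw [← h, show i + (j - i) = j by omega]
              exact ⟨hjspec.2, le_rfl⟩
            · have := h3 (j - i - a - 1) (by omega)
              rw [show a + (j - i - a - 1) + 1 = j - i by omega] at this
              simp only [prepend, lt_irrefl, if_false, Nat.sub_self, hz.2] at this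
              exact absurd this (by decide)
        simp only [prepend] at h1 h3
        rw [if_pos (by omega)] at h1
        refine hx (i + a) g h1 ?_ fun k hk => ?_
        · rw [← hend.1]; congr 1; omega
        · have := h3 k hk
          rw [if_pos (by omega)] at this
          rw [← this]; congr 1; omega
      · simp only [prepend]
        split_ifs
        · exact hxi
        · simpa using hz.2
    · push Not at hex
      refine ⟨n, n, le_rfl, le_rfl, fun l hl => h01 _ (hex l hl), fun l h1 h2 => by omega,
        fun z hz => ?_⟩
      have : prepend x n (n - n) z = z := by
        funext l
        simp [prepend]
      rwa [this]

theorem IsDecomposable.nonempty {X : Set (SymSeq p)} (h : IsDecomposable X) : X.Nonempty := by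
  obtain ⟨X₀, hX₀, hne, -⟩ := h
  exact hne.mono hX₀

theorem IsSGapOrBetaShift.isCompact {X : Set (SymSeq p)} (h : IsSGapOrBetaShift p X) :
    IsCompact X := by
  cases h with
  | sGap S hS => exact (isClosed_sGapShift S).isCompact
  | beta β hβ => exact (isClosed_lexShift _).isCompact
  | betaQuasi β hβ => exact (isClosed_lexShift _).isCompact

theorem IsSGapOrBetaShift.mapsTo_shift {X : Set (SymSeq p)} (h : IsSGapOrBetaShift p X) :
    MapsTo shift X X := by
  cases h with
  | sGap S hS => exact mapsTo_shift_sGapShift S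
  | beta β hβ => exact mapsTo_shift_lexShift _
  | betaQuasi β hβ => exact mapsTo_shift_lexShift _

theorem IsSGapOrBetaShift.isDecomposable {X : Set (SymSeq p)} (h : IsSGapOrBetaShift p X) :
    IsDecomposable X := by
  cases h with
  | sGap S hS => exact isDecomposable_sGapShift S
  | beta β hβ => exact isDecomposable_lexShift (greedyExpansion_mem hβ)
  | betaQuasi β hβ => exact isDecomposable_lexShift (quasiGreedyExpansion_mem hβ)

end Examples

/-! ### Upper and lower dimension bounds via entropy and pressure. -/

section Bounds

variable {p q : ℕ} {X : Set (SymSeq p)} {Y : Set (SymSeq q)}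

-- By `dist_le_of_return` the points of one cylinder with return exponent C have diameter at most
-- e^{-(n+C)}, so the covering sum is a weighted count of words.
open Classical in
theorem dimH_le_of_returns {E : Set (SymSeq q)} (C : (n : ℕ) → (Fin n → Fin q) → ℝ)
    (hE : ∀ x ∈ E, ∃ᶠ n : ℕ in atTop, ∃ w : Fin n → Fin q,
      x ∈ cylinder Y w ∧ dist (shift^[n] x) x ≤ Real.exp (-C n w))
    {t : ℝ} (ht : 0 < t) {θ : ℝ} (hθ : 0 < θ)
    (hsum : ∀ᶠ n : ℕ in atTop, ∑ w : Fin n → Fin q with w ∈ language Y n,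
      Real.exp (-(t * (n + C n w))) ≤ Real.exp (-(θ * n))) :
    dimH E ≤ ENNReal.ofReal t := by
  refine dimH_le_of_covers
    (fun n w => {x | x ∈ cylinder Y w ∧ dist (shift^[n] x) x ≤ Real.exp (-C n w)})
    hE (fun n w x hx l => hx.1.2 l) ht hθ ?_
  filter_upwards [hsum, eventually_gt_atTop 0] with n hn hn0
  refine le_trans ?_ (ENNReal.ofReal_le_ofReal hn)
  rw [ENNReal.ofReal_sum_of_nonneg fun _ _ => (Real.exp_pos _).le, Finset.sum_filter]
  refine Finset.sum_le_sum fun w _ => ?_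
  split_ifs with hw
  · have h1 : Metric.ediam {x | x ∈ cylinder Y w ∧ dist (shift^[n] x) x ≤ Real.exp (-C n w)}
        ≤ ENNReal.ofReal (Real.exp (-(n + C n w))) := by
      refine Metric.ediam_le fun x hx y hy => ?_
      rw [edist_dist]
      exact ENNReal.ofReal_le_ofReal (dist_le_of_return hn0
        (fun l hl => (hx.1.2 ⟨l, hl⟩).trans (hy.1.2 ⟨l, hl⟩).symm) hx.2 hy.2)
    refine (ENNReal.rpow_le_rpow h1 ht.le).trans_eq ?_
    rw [ENNReal.ofReal_rpow_of_nonneg (Real.exp_pos _).le ht.le, ← Real.exp_mul]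
    congr 2
    ring
  · have : {x | x ∈ cylinder Y w ∧ dist (shift^[n] x) x ≤ Real.exp (-C n w)} = ∅ := by
      rw [eq_empty_iff_forall_notMem]
      exact fun x hx => hw ⟨x, hx.1⟩
    rw [this, Metric.ediam_empty, ENNReal.zero_rpow_of_pos ht]

theorem exists_mem_cylinder {x : SymSeq q} (hx : x ∈ Y) (n : ℕ) :
    x ∈ cylinder Y fun i : Fin n => x i :=
  ⟨hx, fun _ => rfl⟩

theorem language_nonempty (hY : Y.Nonempty) (n : ℕ) : (language Y n).Nonempty := by
  obtain ⟨x, hx⟩ := hY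
  exact ⟨_, x, exists_mem_cylinder hx n⟩

theorem language_ncard_pos (hY : Y.Nonempty) (n : ℕ) : 0 < (language Y n).ncard :=
  (Set.ncard_pos (Set.toFinite _)).2 (language_nonempty hY n)

open Classical in
theorem card_filter_language (n : ℕ) :
    (Finset.univ.filter fun w : Fin n → Fin q => w ∈ language Y n).card = (language Y n).ncard := by
  rw [← Set.ncard_coe_finset]
  congr 1
  ext w
  simp

theorem dimH_recurrenceSet_le (hY : Y.Nonempty) {ψ : ℕ → ℝ} {b t h : ℝ} (ht : 0 < t)
    (hψ : ∀ᶠ n : ℕ in atTop, ∀ x ∈ Y, dist (shift^[n] x) x < ψ n →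
      dist (shift^[n] x) x ≤ Real.exp (-(b * n)))
    (hent : entropy Y = (h : EReal)) (hh : h < t * (1 + b)) :
    dimH (recurrenceSet Y ψ) ≤ ENNReal.ofReal t := by
  classical
  set θ := (t * (1 + b) - h) / 2 with hθ
  have hθ0 : 0 < θ := by rw [hθ]; linarith
  refine dimH_le_of_returns (Y := Y) (fun n _ => b * n) (fun x hx => ?_) ht hθ0 ?_
  · have h1 := (Nat.frequently_atTop_iff_infinite.2 hx.2).and_eventually hψ
    exact h1.mono fun n hn => ⟨_, exists_mem_cylinder hx.1 n, hn.2 x hx.1 hn.1⟩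
  · have h1 : entropy Y < ((t * (1 + b) - θ : ℝ) : EReal) := by
      rw [hent, EReal.coe_lt_coe_iff, hθ]; linarith
    filter_upwards [eventually_lt_of_limsup_lt h1, eventually_gt_atTop 0] with n hn hn0
    have hn0' : (0 : ℝ) < n := by exact_mod_cast hn0
    rw [EReal.coe_lt_coe_iff, div_lt_iff₀ hn0',
      Real.log_lt_iff_lt_exp (by exact_mod_cast language_ncard_pos hY n)] at hn
    rw [Finset.sum_const, card_filter_language, nsmul_eq_mul]
    calc ((language Y n).ncard : ℝ) * Real.exp (-(t * (n + b * n)))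
        ≤ Real.exp ((t * (1 + b) - θ) * n) * Real.exp (-(t * (n + b * n))) :=
          mul_le_mul_of_nonneg_right hn.le (Real.exp_pos _).le
      _ = Real.exp (-(θ * n)) := by rw [← Real.exp_add]; ring_nf

/-- The loss m comes from the window of the block code at the end of the repeated stretch. -/
theorem dist_shift_le_of_repeat {b N m : ℕ} {Θ : (ℕ → Fin b) → SymSeq q}
    (hrep : ∀ ω M r, (∀ i < r, ω (M + i) = ω i) →
      ∀ l, l + m ≤ r * N → Θ ω (M * N + l) = Θ ω l) {a : ℝ} {ω : ℕ → Fin b} {M : ℕ}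
    (h : ∀ i : ℕ, (i : ℝ) < a * M → ω (M + i) = ω i) :
    dist (shift^[M * N] (Θ ω)) (Θ ω) ≤ Real.exp (-(a * M * N - m)) := by
  rw [dist_le_exp_neg_iff]
  intro l hl
  rw [shift_iterate_apply, add_comm]
  refine hrep ω M ⌈a * M⌉₊ (fun i hi => h i (Nat.lt_ceil.1 hi)) l ?_
  have h1 : a * M * N ≤ (⌈a * M⌉₊ : ℝ) * N :=
    mul_le_mul_of_nonneg_right (Nat.le_ceil _) (Nat.cast_nonneg _)
  have h2 : ((l + m : ℕ) : ℝ) ≤ ((⌈a * M⌉₊ * N : ℕ) : ℝ) := by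
    push_cast; linarith
  exact_mod_cast h2

/-- One point in each of a set of cylinders. -/
theorem exists_separated_points {n : ℕ} (U : Finset (Fin n → Fin q))
    (pt : (Fin n → Fin q) → SymSeq q) (hpt : ∀ w ∈ U, pt w ∈ cylinder Y w) :
    ∃ V : Finset (SymSeq q), V.card = U.card ∧ (∀ y ∈ V, ∃ w ∈ U, y = pt w) ∧
      (∀ y ∈ V, y ∈ Y) ∧ ∀ y ∈ V, ∀ y' ∈ V, (∀ l < n, y l = y' l) → y = y' := by
  classical
  have hword : ∀ w ∈ U, ∀ w' ∈ U, (∀ l < n, pt w l = pt w' l) → w = w' := by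
    intro w hw w' hw' h
    funext i
    rw [← (hpt w hw).2 i, ← (hpt w' hw').2 i, h i i.2]
  refine ⟨U.image pt, Finset.card_image_of_injOn fun w hw w' hw' h =>
    hword w hw w' hw' fun l _ => by rw [h], fun y hy => ?_, fun y hy => ?_, fun y hy y' hy' h => ?_⟩
  · obtain ⟨w, hw, rfl⟩ := Finset.mem_image.1 hy
    exact ⟨w, hw, rfl⟩
  · obtain ⟨w, hw, rfl⟩ := Finset.mem_image.1 hy
    exact (hpt w hw).1
  · obtain ⟨w, hw, rfl⟩ := Finset.mem_image.1 hy
    obtain ⟨w', hw', rfl⟩ := Finset.mem_image.1 hy'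
    rw [hword w hw w' hw' h]

theorem mapsTo_shift_factor (hinv : MapsTo shift X X) {π : SymSeq p → SymSeq q}
    (hY : π '' X = Y) (hcomm : ∀ x ∈ X, π (shift x) = shift (π x)) : MapsTo shift Y Y := by
  subst hY
  rintro _ ⟨x, hx, rfl⟩
  exact ⟨shift x, hinv hx, hcomm x hx⟩

/-- The horseshoe is built for the zero potential at rate t(1+a), just below entropy; the repetition
ratio is this `a`, and the ratio supplied by the horseshoe is only bounded below by 0. -/
theorem le_dimH_recurrenceSet (hX : IsCompact X) (hinv : MapsTo shift X X)
    (hdec : IsDecomposable X) (hfac : IsFactor X Y) {ψ : ℕ → ℝ} {a t h : ℝ} (ht : 0 < t)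
    (ha : 0 ≤ a)
    (hψ : ∀ N m : ℕ, 0 < N → ∃ᶠ M : ℕ in atTop, Real.exp (-(a * M * N - m)) < ψ (M * N))
    (hent : entropy Y = (h : EReal)) (hh : t * (1 + a) < h) :
    ENNReal.ofReal t ≤ dimH (recurrenceSet Y ψ) := by
  classical
  obtain ⟨π, hπ, hY, hcomm⟩ := hfac
  have hYinv := mapsTo_shift_factor hinv hY hcomm
  have ht1 : 0 < t * (1 + a) := by positivity
  set ε := (h - t * (1 + a)) / 2 with hε
  have hε0 : 0 < ε := by rw [hε]; linarith
  obtain ⟨N, b, m, a', Θ, hN, ha', hΘY, hsep, hrep, hlog, -⟩ :=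
    exists_horseshoe hX hinv hdec hπ hY hcomm hYinv (f := fun _ => 0) continuousOn_const
      (fun _ _ => le_rfl) ht1 hε0 (by
        have h1 : ((t * (1 + a) + ε : ℝ) : EReal) < entropy Y := by
          rw [hent, EReal.coe_lt_coe_iff, hε]; linarith
        refine ((frequently_lt_of_lt_limsup (h := h1)).and_eventually
          (eventually_gt_atTop 0)).mono fun n hn => ?_
        obtain ⟨hn, hn0⟩ := hn
        have hn0' : (0 : ℝ) < n := by exact_mod_cast hn0
        rw [EReal.coe_lt_coe_iff, lt_div_iff₀ hn0'] at hn
        have hpos : (0 : ℝ) < (language Y n).ncard := by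
          rcases Nat.eq_zero_or_pos (language Y n).ncard with h0 | h0
          · rw [h0, Nat.cast_zero, Real.log_zero] at hn
            have : 0 < (t * (1 + a) + ε) * n := by positivity
            linarith
          · exact_mod_cast h0
        rw [Real.lt_log_iff_exp_lt hpos] at hn
        have hch : ∀ w : Fin n → Fin q, ∃ x, w ∈ language Y n → x ∈ cylinder Y w := fun w => by
          by_cases hw : w ∈ language Y n
          · exact ⟨hw.some, fun _ => hw.some_mem⟩
          · obtain ⟨w', hw'⟩ := Set.nonempty_of_ncard_ne_zero
              (s := language Y n) (by exact_mod_cast hpos.ne')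
            exact ⟨hw'.some, fun h => absurd h hw⟩
        choose pt hpt using hch
        obtain ⟨V, hV1, -, hV2, hV3⟩ := exists_separated_points
          (Finset.univ.filter fun w : Fin n → Fin q => w ∈ language Y n) pt
          (fun w hw => hpt w (Finset.mem_filter.1 hw).2)
        refine ⟨V, 0, le_rfl, hV2, hV3, ?_, fun y _ => by simp [birkhoffSum]⟩
        rw [hV1, card_filter_language, add_zero, mul_one]
        exact hn.le)
  have hN' : (0 : ℝ) < N := by exact_mod_cast hN
  obtain ⟨E, hE, hdim⟩ := exists_recurrent_dimH_ge hN ha Θ hsep (hψ N m hN) ht (by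
    refine lt_of_le_of_lt ?_ hlog
    have : 0 ≤ t * (1 + a) * (N * a') := by positivity
    nlinarith)
  refine hdim.trans (dimH_mono ?_)
  rintro _ ⟨ω, hω, rfl⟩
  refine ⟨hΘY ω, Nat.frequently_atTop_iff_infinite.1 ?_⟩
  rw [frequently_atTop]
  intro K
  obtain ⟨M, hKM, hM, hrepeat⟩ := frequently_atTop.1 (hE ω hω) K
  exact ⟨M * N, hKM.trans (Nat.le_mul_of_pos_right M hN),
    (dist_shift_le_of_repeat hrep hrepeat).trans_lt hM⟩

theorem birkhoffSum_neg_mul (f : SymSeq q → ℝ) (t : ℝ) (n : ℕ) (x : SymSeq q) :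
    birkhoffSum shift (fun x => -t * (f x + 1)) n x = -t * (birkhoffSum shift f n x + n) := by
  simp only [birkhoffSum]
  rw [← Finset.mul_sum, Finset.sum_add_distrib]
  simp

theorem birkhoffSum_mono_add (hYinv : MapsTo shift Y Y) {φ ψ : SymSeq q → ℝ} {c : ℝ}
    (h : ∀ x ∈ Y, φ x ≤ ψ x + c) {x : SymSeq q} (hx : x ∈ Y) (n : ℕ) :
    birkhoffSum shift φ n x ≤ birkhoffSum shift ψ n x + c * n := by
  simp only [birkhoffSum]
  refine (Finset.sum_le_sum fun k _ => h _ (shift_iterate_mem hYinv hx k)).trans_eq ?_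
  rw [Finset.sum_add_distrib]
  simp [mul_comm]

theorem bddAbove_birkhoffSum (hYinv : MapsTo shift Y Y) {φ : SymSeq q → ℝ} {B : ℝ}
    (h : ∀ x ∈ Y, φ x ≤ B) {n : ℕ} (w : Fin n → Fin q) :
    BddAbove (birkhoffSum shift φ n '' cylinder Y w) := by
  refine ⟨B * n, ?_⟩
  rintro _ ⟨x, hx, rfl⟩
  have := birkhoffSum_mono_add hYinv (ψ := fun _ => 0) (c := B) (fun x hx => by
    simpa using h x hx) hx.1 n
  simpa [birkhoffSum] using this

theorem partitionSum_pos (hY : Y.Nonempty) (φ : SymSeq q → ℝ) (n : ℕ) :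
    0 < partitionSum Y φ n := by
  classical
  obtain ⟨w, hw⟩ := language_nonempty hY n
  exact Finset.sum_pos (fun _ _ => Real.exp_pos _) ⟨w, by simpa using hw⟩

theorem limsup_le_limsup_add {u v : ℕ → ℝ} {c : ℝ} (h : ∀ᶠ n in atTop, u n ≤ v n + c) :
    limsup (fun n => (u n : EReal)) atTop ≤ limsup (fun n => (v n : EReal)) atTop + c := by
  have h1 : limsup (fun n => (u n : EReal)) atTop
      ≤ limsup ((fun n => (v n : EReal)) + fun _ => (c : EReal)) atTop := by
    refine limsup_le_limsup (h.mono fun n hn => ?_)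
    simp only [Pi.add_apply]
    exact_mod_cast hn
  refine h1.trans ((EReal.limsup_add_le ?_ ?_).trans_eq ?_)
  · right; simp
  · right; simp
  · simp

/-- The bound `B` makes the `sSup` over each cylinder a genuine supremum. -/
theorem pressure_le_add (hY : Y.Nonempty) (hYinv : MapsTo shift Y Y) {φ ψ : SymSeq q → ℝ}
    {B : ℝ} (hψ : ∀ x ∈ Y, ψ x ≤ B) {c : ℝ} (h : ∀ x ∈ Y, φ x ≤ ψ x + c) :
    pressure Y φ ≤ pressure Y ψ + c := by
  classical
  refine limsup_le_limsup_add ?_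
  filter_upwards [eventually_gt_atTop 0] with n hn0
  have hn0' : (0 : ℝ) < n := by exact_mod_cast hn0
  have h1 : partitionSum Y φ n ≤ Real.exp (c * n) * partitionSum Y ψ n := by
    simp only [partitionSum]
    rw [Finset.mul_sum]
    refine Finset.sum_le_sum fun w hw => ?_
    rw [← Real.exp_add, Real.exp_le_exp]
    have hne : (cylinder Y w).Nonempty := (Finset.mem_filter.1 hw).2
    refine csSup_le (hne.image _) ?_
    rintro _ ⟨x, hx, rfl⟩
    have h2 := birkhoffSum_mono_add hYinv h hx.1 n
    have h3 := le_csSup (bddAbove_birkhoffSum hYinv hψ w) ⟨x, hx, rfl⟩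
    linarith
  have h2 := Real.log_le_log (partitionSum_pos hY φ n) h1
  rw [Real.log_mul (Real.exp_pos _).ne' (partitionSum_pos hY ψ n).ne', Real.log_exp] at h2
  rw [div_le_iff₀ hn0', add_mul, div_mul_cancel₀ _ hn0'.ne']
  linarith

theorem pressure_zero (f : SymSeq q → ℝ) :
    pressure Y (fun x => -(0 : ℝ) * (f x + 1)) = entropy Y := by
  classical
  simp only [pressure, entropy]
  congr 1
  funext n
  have : partitionSum Y (fun x => -(0 : ℝ) * (f x + 1)) n = (language Y n).ncard := by
    simp only [partitionSum]
    rw [← card_filter_language, Finset.card_eq_sum_ones, Nat.cast_sum]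
    refine Finset.sum_congr rfl fun w hw => ?_
    have hne : (cylinder Y w).Nonempty := (Finset.mem_filter.1 hw).2
    have himg : birkhoffSum shift (fun x => -(0 : ℝ) * (f x + 1)) n '' cylinder Y w = {0} := by
      rw [Set.eq_singleton_iff_nonempty_unique_mem]
      refine ⟨hne.image _, ?_⟩
      rintro _ ⟨x, -, rfl⟩
      rw [birkhoffSum_neg_mul]
      simp
    rw [himg, csSup_singleton]
    simp
  rw [this]

theorem exists_entropy_eq (hY : Y.Nonempty) : ∃ h : ℝ, 0 ≤ h ∧ entropy Y = (h : EReal) := by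
  have h0 : 0 ≤ entropy Y := by
    have h1 : (0 : EReal) = limsup (fun _ : ℕ => (0 : EReal)) atTop := by simp
    rw [h1]
    refine limsup_le_limsup (Eventually.of_forall fun n => ?_)
    have h2 : (1 : ℝ) ≤ (language Y n).ncard := by exact_mod_cast language_ncard_pos hY n
    exact EReal.coe_nonneg.2 (div_nonneg (Real.log_nonneg h2) (Nat.cast_nonneg n))
  have h1 : entropy Y ≤ ((Real.log q : ℝ) : EReal) := by
    have h1 : ((Real.log q : ℝ) : EReal) = limsup (fun _ : ℕ => ((Real.log q : ℝ) : EReal)) atTop := by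
      simp
    rw [h1]
    refine limsup_le_limsup ?_
    filter_upwards [eventually_gt_atTop 0] with n hn0
    have hn0' : (0 : ℝ) < n := by exact_mod_cast hn0
    rw [EReal.coe_le_coe_iff, div_le_iff₀ hn0', mul_comm, ← Real.log_pow]
    refine Real.log_le_log (by exact_mod_cast language_ncard_pos hY n) ?_
    have := Set.ncard_le_ncard (Set.subset_univ (language Y n))
    rw [Set.ncard_univ, Nat.card_eq_fintype_card] at this
    simp only [Fintype.card_fun, Fintype.card_fin] at this
    exact_mod_cast this
  lift entropy Y to ℝ using ⟨(h1.trans_lt (EReal.coe_lt_top _)).ne,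
    (lt_of_lt_of_le EReal.bot_lt_zero h0).ne'⟩ with h hh
  exact ⟨h, by exact_mod_cast h0, rfl⟩

theorem dimH_birkhoffRecurrenceSet_le (hY : Y.Nonempty) (hYinv : MapsTo shift Y Y)
    {f : SymSeq q → ℝ} (hf0 : ∀ y ∈ Y, 0 ≤ f y) {t : ℝ} (ht : 0 < t)
    (hP : pressure Y (fun x => -t * (f x + 1)) < 0) :
    dimH (birkhoffRecurrenceSet Y f) ≤ ENNReal.ofReal t := by
  classical
  obtain ⟨c, hc1, hc2⟩ := EReal.lt_iff_exists_real_btwn.1 hP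
  have hc0 : c < 0 := by exact_mod_cast hc2
  set φ : SymSeq q → ℝ := fun x => -t * (f x + 1) with hφ
  have hφB : ∀ x ∈ Y, φ x ≤ 0 := fun x hx => by
    have := mul_nonneg ht.le (add_nonneg (hf0 x hx) zero_le_one)
    simp only [hφ]; linarith
  have hexp : ∀ (n : ℕ) (w : Fin n → Fin q),
      -(t * (n + (-(sSup (birkhoffSum shift φ n '' cylinder Y w)) / t - n)))
        = sSup (birkhoffSum shift φ n '' cylinder Y w) := fun n w => by
    field_simp
    ring
  refine dimH_le_of_returns (Y := Y)
    -- This is the infimum of S_n f over the cylinder, so it is a valid return exponent there; t(n +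
    -- C) is then minus the supremum of S_n φ, and the covering sum is the partition sum.
    (fun n w => -(sSup (birkhoffSum shift φ n '' cylinder Y w)) / t - n) (fun x hx => ?_) ht
    (θ := -c) (by linarith) ?_
  · refine (Nat.frequently_atTop_iff_infinite.2 hx.2).mono fun n hn =>
      ⟨_, exists_mem_cylinder hx.1 n, hn.trans ?_⟩
    rw [Real.exp_le_exp, neg_le_neg_iff]
    have h1 := le_csSup (bddAbove_birkhoffSum hYinv hφB fun i : Fin n => x i)
      ⟨x, exists_mem_cylinder hx.1 n, rfl⟩
    rw [hφ, birkhoffSum_neg_mul, ← hφ] at h1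
    rw [sub_le_iff_le_add, div_le_iff₀ ht]
    linarith
  · filter_upwards [eventually_lt_of_limsup_lt hc1, eventually_gt_atTop 0] with n hn hn0
    have hn0' : (0 : ℝ) < n := by exact_mod_cast hn0
    rw [EReal.coe_lt_coe_iff, div_lt_iff₀ hn0', Real.log_lt_iff_lt_exp (partitionSum_pos hY _ _)]
      at hn
    simp only [hexp]
    rw [neg_mul, neg_neg]
    exact hn.le

/-- Positive pressure is turned into a count: among the linearly many integer parts k of S_n f, one
carries a fair share of the partition sum, hence has at least e^{(t(1+a)+ε)n} words with a =
(k+1)/n. -/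
theorem le_dimH_birkhoffRecurrenceSet (hX : IsCompact X) (hinv : MapsTo shift X X)
    (hdec : IsDecomposable X) (hfac : IsFactor X Y) {f : SymSeq q → ℝ} (hf : ContinuousOn f Y)
    (hf0 : ∀ y ∈ Y, 0 ≤ f y) {t : ℝ} (ht : 0 < t)
    (hP : 0 < pressure Y (fun x => -t * (f x + 1))) :
    ENNReal.ofReal t ≤ dimH (birkhoffRecurrenceSet Y f) := by
  classical
  obtain ⟨π, hπ, hY, hcomm⟩ := hfac
  have hYinv := mapsTo_shift_factor hinv hY hcomm
  have hYc : IsCompact Y := hY ▸ hX.image_of_continuousOn hπ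
  obtain ⟨y₀, hy₀⟩ : Y.Nonempty := hY ▸ hdec.nonempty.image _
  obtain ⟨F, hF⟩ := hYc.bddAbove_image hf
  have hF' : ∀ y ∈ Y, f y ≤ F := fun y hy => hF ⟨y, hy, rfl⟩
  have hF0 : 0 ≤ F := (hf0 y₀ hy₀).trans (hF' y₀ hy₀)
  obtain ⟨c, hc1, hc2⟩ := EReal.lt_iff_exists_real_btwn.1 hP
  have hc0 : 0 < c := by exact_mod_cast hc1
  set ε := c / 2 with hε
  have hε0 : 0 < ε := by positivity
  obtain ⟨N, b, m, a, Θ, hN, ha, hΘY, hsep, hrep, hlog, hS⟩ :=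
    exists_horseshoe hX hinv hdec hπ hY hcomm hYinv hf hf0 ht hε0 (by
      refine ((frequently_lt_of_lt_limsup (h := hc2)).and_eventually
        ((eventually_gt_atTop 0).and
          -- The factor e comes from points within 1 of the supremum, e^t from rounding k up to k +
          -- 1, and F + 1 from the number of classes, at most Fn + 1.
          (eventually_poly_le_exp (Real.exp (t + 1) * (F + 1)) 0 hε0))).mono fun n hn => ?_
      obtain ⟨hn, hn0, hpoly⟩ := hn
      have hn0' : (0 : ℝ) < n := by exact_mod_cast hn0
      rw [EReal.coe_lt_coe_iff, lt_div_iff₀ hn0',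
        Real.lt_log_iff_exp_lt (partitionSum_pos ⟨y₀, hy₀⟩ _ _)] at hn
      set U := Finset.univ.filter fun w : Fin n → Fin q => w ∈ language Y n with hU
      have hch : ∀ w : Fin n → Fin q, ∃ x, w ∈ U → x ∈ cylinder Y w ∧
          sSup (birkhoffSum shift (fun x => -t * (f x + 1)) n '' cylinder Y w) - 1
            < -t * (birkhoffSum shift f n x + n) := fun w => by
        by_cases hw : w ∈ U
        · have hne : (cylinder Y w).Nonempty := (Finset.mem_filter.1 hw).2
          obtain ⟨_, ⟨x, hx, rfl⟩, hlt⟩ := exists_lt_of_lt_csSup (hne.image _)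
            (sub_one_lt (sSup (birkhoffSum shift (fun x => -t * (f x + 1)) n '' cylinder Y w)))
          rw [birkhoffSum_neg_mul] at hlt
          exact ⟨x, fun _ => ⟨hx, hlt⟩⟩
        · exact ⟨y₀, fun h => absurd h hw⟩
      choose pt hpt using hch
      set κ : (Fin n → Fin q) → ℕ := fun w => ⌊birkhoffSum shift f n (pt w)⌋₊ with hκ
      have hSnn : ∀ w ∈ U, 0 ≤ birkhoffSum shift f n (pt w) := fun w hw =>
        Finset.sum_nonneg fun k _ => hf0 _ (shift_iterate_mem hYinv (hpt w hw).1.1 k)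
      have hSF : ∀ w ∈ U, birkhoffSum shift f n (pt w) ≤ F * n := fun w hw => by
        have := birkhoffSum_mono_add hYinv (ψ := fun _ => 0) (c := F) (fun x hx => by
          simpa using hF' x hx) (hpt w hw).1.1 n
        simpa [birkhoffSum] using this
      have hsum : partitionSum Y (fun x => -t * (f x + 1)) n
          ≤ Real.exp (1 - t * n) * ∑ w ∈ U, Real.exp (-(t * κ w)) := by
        simp only [partitionSum]
        rw [Finset.mul_sum]
        refine Finset.sum_le_sum fun w hw => ?_
        rw [← Real.exp_add, Real.exp_le_exp]
        have h1 := (hpt w hw).2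
        have h2 := mul_le_mul_of_nonneg_left (Nat.floor_le (hSnn w hw)) ht.le
        simp only [hκ]
        linarith
      set Q := ⌊F * n⌋₊ + 1 with hQ
      have hQ0 : (0 : ℝ) < Q := by
        rw [hQ]; positivity
      obtain ⟨k, -, hk⟩ := Finset.exists_le_sum_fiber_of_maps_to_of_nsmul_le_sum
        (s := U) (t := Finset.range Q) (f := κ) (w := fun w => Real.exp (-(t * κ w)))
        (b := (∑ w ∈ U, Real.exp (-(t * κ w))) / Q)
        (fun w hw => Finset.mem_range.2 (Nat.lt_succ_of_le (Nat.floor_mono (hSF w hw))))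
        ⟨0, Finset.mem_range.2 (Nat.succ_pos _)⟩ (by
          rw [Finset.card_range, nsmul_eq_mul, mul_div_cancel₀ _ hQ0.ne'])
      have hk' : ∑ w ∈ U with κ w = k, Real.exp (-(t * κ w))
          = ((U.filter fun w => κ w = k).card : ℝ) * Real.exp (-(t * k)) := by
        rw [Finset.sum_congr rfl (g := fun _ => Real.exp (-(t * k))) fun w hw => by
          rw [(Finset.mem_filter.1 hw).2], Finset.sum_const, nsmul_eq_mul]
      rw [hk'] at hk
      rw [div_le_iff₀ hQ0] at hk
      obtain ⟨V, hV1, hV2, hV3, hV4⟩ := exists_separated_points (Y := Y)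
        (U.filter fun w => κ w = k) pt fun w hw => (hpt w (Finset.mem_filter.1 hw).1).1
      refine ⟨V, (k + 1) / n, by positivity, hV3, hV4, ?_, fun y hy => ?_⟩
      · rw [hV1]
        have hQle : Real.exp (t + 1) * Q ≤ Real.exp (ε * n) := by
          refine le_trans ?_ hpoly
          rw [mul_assoc]
          refine mul_le_mul_of_nonneg_left ?_ (Real.exp_pos _).le
          have h1 : (Q : ℝ) ≤ F * n + 1 := by
            rw [hQ]; push_cast
            linarith [Nat.floor_le (show 0 ≤ F * n by positivity)]
          have h2 : (1 : ℝ) ≤ n := by exact_mod_cast hn0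
          push_cast
          nlinarith [mul_nonneg hF0 hn0'.le, mul_nonneg hF0 (sq_nonneg (n : ℝ))]
        set G : ℝ := ((U.filter fun w => κ w = k).card : ℝ) with hG
        have h1 : Real.exp (c * n) ≤ Real.exp (1 - t * n) * (G * Real.exp (-(t * k)) * Q) :=
          hn.le.trans (hsum.trans (mul_le_mul_of_nonneg_left hk (Real.exp_pos _).le))
        have h2 : Real.exp ((t * (1 + (k + 1) / n) + ε) * n) * Q * Real.exp (1 - t * n - t * k)
            ≤ G * Q * Real.exp (1 - t * n - t * k) := by
          calc _ = Real.exp (ε * n) * (Real.exp (t + 1) * Q) := by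
                have : (t * (1 + ((k : ℝ) + 1) / n) + ε) * n = t * n + t * (k + 1) + ε * n := by
                  field_simp
                rw [this, mul_right_comm, ← Real.exp_add, ← mul_assoc, ← Real.exp_add]
                ring_nf
            _ ≤ Real.exp (ε * n) * Real.exp (ε * n) :=
                mul_le_mul_of_nonneg_left hQle (Real.exp_pos _).le
            _ = Real.exp (c * n) := by rw [← Real.exp_add, hε]; ring_nf
            _ ≤ _ := h1
            _ = _ := by
                rw [show 1 - t * n - t * k = (1 - t * n) + -(t * k) by ring, Real.exp_add]
                ring
        exact le_of_mul_le_mul_right (le_of_mul_le_mul_right h2 (Real.exp_pos _)) hQ0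
      · obtain ⟨w, hw, rfl⟩ := hV2 y hy
        have h1 := (Finset.mem_filter.1 hw).2
        rw [div_mul_cancel₀ _ hn0'.ne', ← h1]
        exact (Nat.lt_floor_add_one _).le)
  have hN' : (0 : ℝ) < N := by exact_mod_cast hN
  obtain ⟨E, hE, hdim⟩ := exists_recurrent_dimH_ge (P := fun _ => True) hN ha Θ hsep
    (Eventually.frequently (Eventually.of_forall fun _ => trivial)) ht hlog
  refine hdim.trans (dimH_mono ?_)
  rintro _ ⟨ω, hω, rfl⟩
  refine ⟨hΘY ω, Nat.frequently_atTop_iff_infinite.1 ?_⟩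
  rw [frequently_atTop]
  intro K
  obtain ⟨M, hKM, -, hrepeat⟩ := frequently_atTop.1 (hE ω hω) (max K m)
  refine ⟨M * N, ((le_max_left _ _).trans hKM).trans (Nat.le_mul_of_pos_right M hN),
    (dist_shift_le_of_repeat hrep hrepeat).trans ?_⟩
  rw [Real.exp_le_exp, neg_le_neg_iff]
  have h1 : (m : ℝ) ≤ M := by exact_mod_cast (le_max_right _ _).trans hKM
  have h2 := hS ω M
  linarith

end Bounds

/-! ### The root of the pressure equation and the dimension formulas. -/

section Main

variable {p q : ℕ} {X : Set (SymSeq p)} {Y : Set (SymSeq q)}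

theorem ennreal_toEReal_eq_of_cuts {D : ℝ≥0∞} {s : ℝ} (hs : 0 ≤ s)
    (hle : ∀ t : ℝ, s < t → D ≤ ENNReal.ofReal t)
    (hge : ∀ t : ℝ, 0 < t → t < s → ENNReal.ofReal t ≤ D) : (D : EReal) = (s : EReal) := by
  have hD : D ≠ ∞ := ((hle (s + 1) (by linarith)).trans_lt ENNReal.ofReal_lt_top).ne
  lift D to ℝ≥0 using hD
  have h1 : (D : ℝ) ≤ s := le_of_forall_gt_imp_ge_of_dense fun t ht => by
    have := hle t ht
    rw [ENNReal.ofReal, ENNReal.coe_le_coe] at this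
    have h2 : (D : ℝ) ≤ t.toNNReal := this
    rwa [Real.coe_toNNReal _ (hs.trans ht.le)] at h2
  have h2 : s ≤ D := le_of_forall_lt_imp_le_of_dense fun t ht => by
    rcases le_or_gt t 0 with h0 | h0
    · exact h0.trans D.2
    · have := hge t h0 ht
      rw [ENNReal.ofReal, ENNReal.coe_le_coe] at this
      have h2 : (t.toNNReal : ℝ) ≤ D := this
      rwa [Real.coe_toNNReal _ h0.le] at h2
  rw [← le_antisymm h1 h2]
  rfl

theorem decayRate_nonneg {ψ : ℕ → ℝ} (hψ : ∀ n, 0 < ψ n) (hanti : Antitone ψ) :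
    0 ≤ decayRate ψ := by
  have h1 : Tendsto (fun n : ℕ => ((-Real.log (ψ 0) / n : ℝ) : EReal)) atTop (𝓝 ((0 : ℝ) : EReal)) :=
    (continuous_coe_real_ereal.tendsto 0).comp
      (tendsto_const_nhds.div_atTop tendsto_natCast_atTop_atTop)
  rw [← EReal.coe_zero, ← h1.liminf_eq]
  refine liminf_le_liminf (Eventually.of_forall fun n => ?_)
  rw [EReal.coe_le_coe_iff]
  exact div_le_div_of_nonneg_right
    (neg_le_neg (Real.log_le_log (hψ n) (hanti (Nat.zero_le n)))) (Nat.cast_nonneg n)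

/-- The case b = 0 is separate because the decay rate may itself be 0; it holds since all distances
are at most 1. -/
theorem eventually_dist_le_of_lt_decayRate {ψ : ℕ → ℝ} (hψ : ∀ n, 0 < ψ n) {b : ℝ}
    (hb : b = 0 ∨ (b : EReal) < decayRate ψ) :
    ∀ᶠ n : ℕ in atTop, ∀ x ∈ Y, dist (shift^[n] x) x < ψ n →
      dist (shift^[n] x) x ≤ Real.exp (-(b * n)) := by
  rcases hb with rfl | hb
  · refine Eventually.of_forall fun n x _ _ => ?_
    rw [zero_mul, dist_le_exp_neg_iff]
    intro l hl
    exact absurd hl (not_lt.2 (Nat.cast_nonneg l))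
  · filter_upwards [eventually_lt_of_lt_liminf hb, eventually_gt_atTop 0] with n hn hn0 x _ hx
    have hn0' : (0 : ℝ) < n := by exact_mod_cast hn0
    rw [EReal.coe_lt_coe_iff, lt_div_iff₀ hn0', lt_neg, Real.log_lt_iff_lt_exp (hψ n)] at hn
    exact hx.le.trans hn.le

/-- Good times n need not be multiples of N; monotonicity allows rounding n down, as ψ can only
grow. -/
theorem frequently_exp_lt_of_decayRate_lt {ψ : ℕ → ℝ} (hψ : ∀ n, 0 < ψ n) (hanti : Antitone ψ)
    {a : ℝ} (ha : decayRate ψ < a) (N m : ℕ) (hN : 0 < N) :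
    ∃ᶠ M : ℕ in atTop, Real.exp (-(a * M * N - m)) < ψ (M * N) := by
  obtain ⟨b, hb1, hb2⟩ := EReal.lt_iff_exists_real_btwn.1 ha
  have hb0 : 0 ≤ b := by exact_mod_cast (decayRate_nonneg hψ hanti).trans hb1.le
  have hab : 0 < a - b := sub_pos.2 (by exact_mod_cast hb2)
  have hN' : (0 : ℝ) < N := by exact_mod_cast hN
  rw [frequently_atTop]
  intro K
  -- The threshold ensures (a - b)MN ≥ bN + m for M = n / N, which pays for the rounding and for m.
  obtain ⟨n, hn, hlt⟩ := frequently_atTop.1 (frequently_lt_of_liminf_lt (h := hb1))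
    ((max K ⌈(b * N + m) / ((a - b) * N)⌉₊ + 1) * N)
  have hn0 : (0 : ℝ) < n := by
    have : 0 < n := lt_of_lt_of_le (by positivity) hn
    exact_mod_cast this
  have hM : max K ⌈(b * N + m) / ((a - b) * N)⌉₊ ≤ n / N :=
    (Nat.le_succ _).trans ((Nat.le_div_iff_mul_le hN).2 hn)
  refine ⟨n / N, (le_max_left _ _).trans hM, ?_⟩
  rw [EReal.coe_lt_coe_iff, div_lt_iff₀ hn0, neg_lt, Real.lt_log_iff_exp_lt (hψ n)] at hlt
  refine lt_of_le_of_lt ?_ (hlt.trans_le (hanti (Nat.div_mul_le_self n N)))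
  rw [Real.exp_le_exp, neg_le_neg_iff]
  have h1 : (n : ℝ) ≤ ((n / N : ℕ) + 1) * N := by
    have : n ≤ (n / N + 1) * N := by
      rw [add_mul, one_mul]; exact (Nat.lt_div_mul_add hN).le
    exact_mod_cast this
  have h2 : (b * N + m) / ((a - b) * N) ≤ ((n / N : ℕ) : ℝ) :=
    (Nat.le_ceil _).trans (by exact_mod_cast (le_max_right _ _).trans hM)
  rw [div_le_iff₀ (by positivity)] at h2
  have h3 := mul_le_mul_of_nonneg_left h1 hb0
  linarith

theorem eventually_exp_lt_of_pos_liminf {ψ : ℕ → ℝ}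
    (hpos : 0 < liminf (fun n => (ψ n : EReal)) atTop) {a : ℝ} (ha : 0 < a) (N m : ℕ)
    (hN : 0 < N) : ∀ᶠ M : ℕ in atTop, Real.exp (-(a * M * N - m)) < ψ (M * N) := by
  obtain ⟨c, hc1, hc2⟩ := EReal.lt_iff_exists_real_btwn.1 hpos
  have hc0 : 0 < c := by exact_mod_cast hc1
  have hN' : (0 : ℝ) < N := by exact_mod_cast hN
  have h1 : Tendsto (fun M : ℕ => M * N) atTop atTop :=
    tendsto_id.atTop_mul_const' hN
  have h2 : Tendsto (fun M : ℕ => Real.exp (-(a * M * N - m))) atTop (𝓝 0) := by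
    refine Real.tendsto_exp_neg_atTop_nhds_zero.comp ?_
    refine tendsto_atTop_add_const_right _ _ ?_
    exact (tendsto_natCast_atTop_atTop.const_mul_atTop ha).atTop_mul_const hN'
  filter_upwards [h1.eventually (eventually_lt_of_lt_liminf hc2),
    h2.eventually (gt_mem_nhds hc0)] with M hM1 hM2
  exact hM2.trans (by exact_mod_cast hM1)

/-- Since 1 ≤ f + 1 ≤ F + 1, the pressure has slopes between -(F+1) and -1 in t. It equals the
entropy h ≥ 0 at t = 0 and is at most 0 at t = h, so its zero lies in [0, h]. -/
theorem exists_pressure_zero (hY : Y.Nonempty) (hYc : IsCompact Y) (hYinv : MapsTo shift Y Y)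
    {f : SymSeq q → ℝ} (hf : ContinuousOn f Y) (hf0 : ∀ y ∈ Y, 0 ≤ f y) :
    ∃ s : ℝ, 0 ≤ s ∧ pressure Y (fun x => -s * (f x + 1)) = 0 ∧
      (∀ t, s < t → pressure Y (fun x => -t * (f x + 1)) < 0) ∧
      ∀ t, t < s → 0 < pressure Y (fun x => -t * (f x + 1)) := by
  obtain ⟨F, hF⟩ := hYc.bddAbove_image hf
  have hF' : ∀ y ∈ Y, f y ≤ F := fun y hy => hF ⟨y, hy, rfl⟩
  have hF0 : 0 ≤ F := by
    obtain ⟨y, hy⟩ := hY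
    exact (hf0 y hy).trans (hF' y hy)
  set P : ℝ → EReal := fun t => pressure Y (fun x => -t * (f x + 1)) with hP
  have hbdd : ∀ t : ℝ, ∀ x ∈ Y, -t * (f x + 1) ≤ |t| * (F + 1) := fun t x hx => by
    have h1 : -t * (f x + 1) ≤ |t| * (f x + 1) :=
      mul_le_mul_of_nonneg_right (neg_le_abs t) (by linarith [hf0 x hx])
    exact h1.trans (mul_le_mul_of_nonneg_left (by linarith [hF' x hx]) (abs_nonneg t))
  have hdec : ∀ t t' : ℝ, t ≤ t' → P t' ≤ P t + ((-(t' - t) : ℝ) : EReal) := fun t t' h =>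
    pressure_le_add hY hYinv (hbdd t) fun x hx => by
      nlinarith [mul_nonneg (sub_nonneg.2 h) (hf0 x hx)]
  have hlip : ∀ t t' : ℝ, t ≤ t' → P t ≤ P t' + (((t' - t) * (F + 1) : ℝ) : EReal) :=
    fun t t' h => pressure_le_add hY hYinv (hbdd t') fun x hx => by
      nlinarith [mul_nonneg (sub_nonneg.2 h) (sub_nonneg.2 (hF' x hx))]
  obtain ⟨h, hh0, hh⟩ := exists_entropy_eq hY
  have hP0 : P 0 = (h : EReal) := (pressure_zero f).trans hh
  have hreal : ∀ t, ∃ u : ℝ, P t = (u : EReal) := by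
    intro t
    have h1 : P t ≠ ⊤ := by
      rcases le_total 0 t with h | h
      · intro e
        have := hdec 0 t h
        rw [e, hP0, ← EReal.coe_add] at this
        exact EReal.coe_ne_top _ (top_le_iff.1 this)
      · intro e
        have := hlip t 0 h
        rw [e, hP0, ← EReal.coe_add] at this
        exact EReal.coe_ne_top _ (top_le_iff.1 this)
    have h2 : P t ≠ ⊥ := by
      rcases le_total 0 t with h | h
      · intro e
        have := hlip 0 t h
        rw [e, hP0, EReal.bot_add] at this
        exact EReal.coe_ne_bot _ (le_bot_iff.1 this)
      · intro e
        have := hdec t 0 h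
        rw [e, hP0, EReal.bot_add] at this
        exact EReal.coe_ne_bot _ (le_bot_iff.1 this)
    exact ⟨(P t).toReal, (EReal.coe_toReal h1 h2).symm⟩
  choose r hr using hreal
  have hdec' : ∀ t t' : ℝ, t ≤ t' → r t' ≤ r t + -(t' - t) := fun t t' h => by
    have := hdec t t' h
    rw [hr, hr] at this
    exact_mod_cast this
  have hlip' : ∀ t t' : ℝ, t ≤ t' → r t ≤ r t' + (t' - t) * (F + 1) := fun t t' h => by
    have := hlip t t' h
    rw [hr, hr] at this
    exact_mod_cast this
  have hr0 : r 0 = h := by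
    have := hr 0
    rw [hP0] at this
    exact_mod_cast this.symm
  have hcont : Continuous r := by
    refine (LipschitzWith.of_le_add_mul (⟨F + 1, by linarith⟩ : ℝ≥0) fun t t' => ?_).continuous
    change r t ≤ r t' + (F + 1) * dist t t'
    rw [Real.dist_eq]
    rcases le_total t t' with h | h
    · have := hlip' t t' h
      rw [abs_sub_comm, abs_of_nonneg (sub_nonneg.2 h)]
      linarith
    · have h1 := hdec' t' t h
      have h2 : 0 ≤ (F + 1) * |t - t'| := by positivity
      linarith
  obtain ⟨s, hs, hrs⟩ := intermediate_value_Icc' hh0 hcont.continuousOn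
    (show (0 : ℝ) ∈ Icc (r h) (r 0) from ⟨by linarith [hdec' 0 h hh0], by linarith⟩)
  refine ⟨s, hs.1, ?_, fun t ht => ?_, fun t ht => ?_⟩
  · change P s = 0
    rw [hr, hrs, EReal.coe_zero]
  · change P t < 0
    rw [hr, ← EReal.coe_zero, EReal.coe_lt_coe_iff]
    linarith [hdec' s t ht.le]
  · change 0 < P t
    rw [hr, ← EReal.coe_zero, EReal.coe_lt_coe_iff]
    linarith [hdec' t s ht.le]

theorem dimH_recurrenceSet_of_liminf_pos (hX : IsCompact X) (hinv : MapsTo shift X X)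
    (hdec : IsDecomposable X) (hfac : IsFactor X Y) (hY : Y.Nonempty) {ψ : ℕ → ℝ}
    (hψ : ∀ n, 0 < ψ n) (hpos : 0 < liminf (fun n => (ψ n : EReal)) atTop) :
    (dimH (recurrenceSet Y ψ) : EReal) = entropy Y := by
  obtain ⟨h, hh0, hh⟩ := exists_entropy_eq hY
  rw [hh]
  refine ennreal_toEReal_eq_of_cuts hh0 (fun t ht => ?_) fun t ht0 ht => ?_
  · exact dimH_recurrenceSet_le hY (hh0.trans_lt ht)
      (eventually_dist_le_of_lt_decayRate hψ (Or.inl rfl)) hh (by linarith)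
  -- Makes t(1 + a) the midpoint of t and h; any positive `a` is allowed because ψ stays away from
  -- 0.
  · have ha : 0 < (h - t) / (2 * t) := div_pos (by linarith) (by linarith)
    refine le_dimH_recurrenceSet hX hinv hdec hfac ht0 ha.le
      (fun N m hN => (eventually_exp_lt_of_pos_liminf hpos ha N m hN).frequently) hh ?_
    have : t * (1 + (h - t) / (2 * t)) = (h + t) / 2 := by field_simp; ring
    linarith

theorem dimH_recurrenceSet_of_antitone (hX : IsCompact X) (hinv : MapsTo shift X X)
    (hdec : IsDecomposable X) (hfac : IsFactor X Y) (hY : Y.Nonempty) {ψ : ℕ → ℝ}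
    (hψ : ∀ n, 0 < ψ n) (hanti : Antitone ψ) :
    (dimH (recurrenceSet Y ψ) : EReal) = entropy Y / (1 + decayRate ψ) := by
  obtain ⟨h, hh0, hh⟩ := exists_entropy_eq hY
  have hb0 := decayRate_nonneg hψ hanti
  have hupper : ∀ b t : ℝ, b = 0 ∨ (b : EReal) < decayRate ψ → 0 < t → h < t * (1 + b) →
      dimH (recurrenceSet Y ψ) ≤ ENNReal.ofReal t := fun b t hb ht hht =>
    dimH_recurrenceSet_le hY ht (eventually_dist_le_of_lt_decayRate hψ hb) hh hht
  rw [hh]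
  rcases eq_or_ne (decayRate ψ) ⊤ with htop | htop
  · have : (h : EReal) / (1 + decayRate ψ) = ((0 : ℝ) : EReal) := by
      rw [htop]
      have : (1 : EReal) + ⊤ = ⊤ := by
        rw [← EReal.coe_one]; exact EReal.coe_add_top 1
      rw [this, EReal.div_top, EReal.coe_zero]
    rw [this]
    refine ennreal_toEReal_eq_of_cuts le_rfl (fun t ht => ?_) fun t h1 h2 => absurd h2 (by linarith)
    refine hupper (h / t) t (Or.inr ?_) ht ?_
    · rw [htop]; exact EReal.coe_lt_top _
    · have : t * (1 + h / t) = t + h := by field_simp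
      linarith
  · obtain ⟨b, hb⟩ : ∃ b : ℝ, decayRate ψ = (b : EReal) :=
      ⟨_, (EReal.coe_toReal htop (lt_of_lt_of_le EReal.bot_lt_zero hb0).ne').symm⟩
    rw [hb] at hb0
    have hb0' : 0 ≤ b := by exact_mod_cast hb0
    have hb1 : 0 < 1 + b := by linarith
    have : (h : EReal) / (1 + decayRate ψ) = ((h / (1 + b) : ℝ) : EReal) := by
      rw [hb, EReal.coe_div, EReal.coe_add, EReal.coe_one]
    rw [this]
    refine ennreal_toEReal_eq_of_cuts (by positivity) (fun t ht => ?_) fun t ht0 ht => ?_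
    · have ht0 : 0 < t := lt_of_le_of_lt (by positivity) ht
      rw [div_lt_iff₀ hb1] at ht
      rcases hb0'.eq_or_lt with rfl | hbpos
      · exact hupper 0 t (Or.inl rfl) ht0 ht
      · rcases le_or_gt b ((t * (1 + b) - h) / (2 * t)) with hle | hlt
        · refine hupper 0 t (Or.inl rfl) ht0 ?_
          rw [le_div_iff₀ (by linarith)] at hle
          nlinarith [mul_pos ht0 hbpos]
        · have hd : 0 < (t * (1 + b) - h) / (2 * t) := div_pos (by linarith) (by linarith)
          -- Lowering b by this amount moves t(1 + b) to its midpoint with h, keeping it above h.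
          refine hupper (b - (t * (1 + b) - h) / (2 * t)) t (Or.inr ?_) ht0 ?_
          · rw [hb, EReal.coe_lt_coe_iff]; linarith
          · have : t * (1 + (b - (t * (1 + b) - h) / (2 * t))) = (t * (1 + b) + h) / 2 := by
              field_simp; ring
            linarith
    · rw [lt_div_iff₀ hb1] at ht
      have hd : 0 < (h - t * (1 + b)) / (2 * t) := div_pos (by linarith) (by linarith)
      refine le_dimH_recurrenceSet hX hinv hdec hfac ht0
        (a := b + (h - t * (1 + b)) / (2 * t)) (by linarith)
        (frequently_exp_lt_of_decayRate_lt hψ hanti ?_) hh ?_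
      · rw [hb, EReal.coe_lt_coe_iff]; linarith
      · have : t * (1 + (b + (h - t * (1 + b)) / (2 * t))) = (h + t * (1 + b)) / 2 := by
          field_simp; ring
        linarith

theorem exists_dimH_birkhoffRecurrenceSet (hX : IsCompact X) (hinv : MapsTo shift X X)
    (hdec : IsDecomposable X) (hfac : IsFactor X Y) (hY : Y.Nonempty) {f : SymSeq q → ℝ}
    (hf : ContinuousOn f Y) (hf0 : ∀ y ∈ Y, 0 ≤ f y) :
    ∃ s : ℝ, (dimH (birkhoffRecurrenceSet Y f) : EReal) = (s : EReal) ∧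
      ∀ t : ℝ, pressure Y (fun x => -t * (f x + 1)) = 0 ↔ t = s := by
  obtain ⟨π, hπ, hπY, hcomm⟩ := id hfac
  have hYinv := mapsTo_shift_factor hinv hπY hcomm
  have hYc : IsCompact Y := hπY ▸ hX.image_of_continuousOn hπ
  obtain ⟨s, hs0, hs, hneg, hpos⟩ := exists_pressure_zero hY hYc hYinv hf hf0
  refine ⟨s, ennreal_toEReal_eq_of_cuts hs0 (fun t ht => ?_) fun t ht0 ht => ?_, fun t => ?_⟩
  · exact dimH_birkhoffRecurrenceSet_le hY hYinv hf0 (hs0.trans_lt ht) (hneg t ht)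
  · exact le_dimH_birkhoffRecurrenceSet hX hinv hdec hfac hf hf0 ht0 (hpos t ht)
  · refine ⟨fun h => ?_, fun h => h ▸ hs⟩
    rcases lt_trichotomy t s with hlt | heq | hgt
    · exact absurd h (hpos t hlt).ne'
    · exact heq
    · exact absurd h (hneg t hgt).ne

end Main

end SymbolicRecurrence

open SymbolicRecurrence
/-- Dimension formulas for the recurrence sets `R(ψ)` and `R(f)` in every factor `Y` of an
`S`-gap shift or a `β`-shift `X` (in particular in `X` itself). -/
theorem mainTheorem3 {p q : ℕ} (X : Set (SymSeq p)) (Y : Set (SymSeq q))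
    (hX : IsSGapOrBetaShift p X) (hY : IsFactor X Y) :
    (∀ ψ : ℕ → ℝ, (∀ n, 0 < ψ n) →
      (0 < Filter.liminf (fun n => (ψ n : EReal)) Filter.atTop →
        (dimH (recurrenceSet Y ψ) : EReal) = entropy Y) ∧
      (Antitone ψ →
        (dimH (recurrenceSet Y ψ) : EReal) = entropy Y / (1 + decayRate ψ))) ∧
    (∀ f : SymSeq q → ℝ, ContinuousOn f Y → (∀ x ∈ Y, 0 < f x) →
      ∃ s : ℝ, (dimH (birkhoffRecurrenceSet Y f) : EReal) = (s : EReal) ∧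
        ∀ t : ℝ, pressure Y (fun x => -t * (f x + 1)) = 0 ↔ t = s) := by
  have hne : Y.Nonempty := by
    obtain ⟨π, -, hπ, -⟩ := hY
    exact hπ ▸ hX.isDecomposable.nonempty.image _
  exact ⟨fun ψ hψ => ⟨
      dimH_recurrenceSet_of_liminf_pos hX.isCompact hX.mapsTo_shift hX.isDecomposable hY hne hψ,
      dimH_recurrenceSet_of_antitone hX.isCompact hX.mapsTo_shift hX.isDecomposable hY hne hψ⟩,
    fun f hf hf0 => exists_dimH_birkhoffRecurrenceSet hX.isCompact hX.mapsTo_shift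
      hX.isDecomposable hY hne hf fun y hy => (hf0 y hy).le⟩
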